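/- Consider a Galton--Watson branching process $\mathbf Z(n)=(Z_1(n),\dots,Z_N(n))$, $n=0,1,2,\dots$, with $N$ types of particles. Let $\eta_{i,j}$ be the number of type $j$ children of a type $i$ particle, and assume that $\eta_{i,j}=0$ almost surely for $j<i$. Put $m_{i,j}=\mathbf E[\eta_{i,j}]$ and $b_i=\tfrac12\operatorname{Var}[\eta_{i,i}]$. Assume that \[ m_{i,i}=1,\quad \mathbf E[\eta_{i,j}\eta_{i,k}]<\infty\ (j,k=i,\dots,N),\quad b_i\in(0,\infty)\qquad (i=1,\dots,N), \] \[ m_{i,i+1}\in(0,\infty)\qquad (i=1,\dots,N-1). \] For $i=1,\dots,N$ set $\gamma_i=2^{-(N-i)}$ and \[ c_{i,N}=\Bigl(\frac1{b_N}\Bigr)^{1/2^{N-i}}\prod_{j=i}^{N-1}\Bigl(\frac{m_{j,j+1}}{b_j}\Bigr)^{1/2^{\,j-i+1}}, \] and let $T_{iN}=\min\{n\ge 1: Z_i(n)+Z_{i+1}(n)+\dots+Z_N(n)=0\}$ be the extinction moment of the process started at time $0$ from a single particle of type $i$. Then, for every $i=1,\dots,N$, as $n\to\infty$, \[ \mathbf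 P(T_{iN}=n)\sim\frac{\gamma_i\,c_{i,N}}{n^{1+\gamma_i}}, \] that is, the ratio of the two sides tends to $1$. -/

import Mathlib

open MeasureTheory ProbabilityTheory Filter Topology
open scoped Asymptotics

/-! Galton-Watson processes with `M + 1` types of particles. The types are the elements
`0, 1, ..., M` of `Fin (M + 1)`; type `i` here is the type usually labelled `i + 1`, so the number
of types is `N = M + 1` and the last type `N` is `Fin.last M`. For every type `i` the law
of the offspring vector `(η_{i,j})_j` of a type `i` particle is a probability measure `ν i` on
`Fin (M + 1) → ℕ`. -/

noncomputable section

namespace DecomposableGW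

variable {M : ℕ}

/-- `m_{i,j} = E[η_{i,j}]`, the mean number of type `j` children of a type `i` particle. -/
def meanOffspring (ν : Fin (M + 1) → Measure (Fin (M + 1) → ℕ)) (i j : Fin (M + 1)) : ℝ :=
  ∫ x, (x j : ℝ) ∂(ν i)

/-- `b_i = Var[η_{i,i}] / 2`. -/
def halfVar (ν : Fin (M + 1) → Measure (Fin (M + 1) → ℕ)) (i : Fin (M + 1)) : ℝ :=
  variance (fun x : Fin (M + 1) → ℕ => (x i : ℝ)) (ν i) / 2

/-- Strongly critical decomposable offspring laws with finite second moments. The first moments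
are finite as a consequence of `secondMoments`, since `η ≤ η ^ 2` for `ℕ`-valued `η`. -/
structure HypothesisA (ν : Fin (M + 1) → Measure (Fin (M + 1) → ℕ)) : Prop where
  /-- A type `i` particle has children of types `j ≥ i` only. -/
  decomposable : ∀ i j, j < i → ∀ᵐ x ∂(ν i), x j = 0
  /-- `m_{i,i} = 1`. -/
  critical : ∀ i, meanOffspring ν i i = 1
  /-- `m_{i,i+1} > 0`. -/
  next_pos : ∀ i : Fin M, 0 < meanOffspring ν i.castSucc i.succ
  /-- `E[η_{i,j} η_{i,k}] < ∞` for `j, k ≥ i`. -/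
  secondMoments : ∀ i j k, i ≤ j → i ≤ k →
    Integrable (fun x : Fin (M + 1) → ℕ => (x j : ℝ) * (x k : ℝ)) (ν i)
  /-- `b_i > 0`. -/
  halfVar_pos : ∀ i, 0 < halfVar ν i

/-- `Z` is a Galton-Watson process with offspring laws `ν`, started at time `0` from one particle
of type `i`: there are independent random vectors `ξ n l k` (the offspring of the `k`-th type `l`
particle of generation `n`), `ξ n l k` with law `ν l`, such that generation `n + 1` consists
of the offspring of all particles of generation `n`. -/
def IsGWProcess {Ω : Type*} [MeasurableSpace Ω] (P : Measure Ω)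
    (ν : Fin (M + 1) → Measure (Fin (M + 1) → ℕ)) (i : Fin (M + 1))
    (Z : ℕ → Ω → Fin (M + 1) → ℕ) : Prop :=
  ∃ ξ : ℕ → Fin (M + 1) → ℕ → Ω → Fin (M + 1) → ℕ,
    (∀ n l k, Measurable (ξ n l k)) ∧
    (∀ n l k, P.map (ξ n l k) = ν l) ∧
    iIndepFun (fun a : ℕ × Fin (M + 1) × ℕ => ξ a.1 a.2.1 a.2.2) P ∧
    (∀ ω, Z 0 ω = Pi.single i 1) ∧
    ∀ n ω, Z (n + 1) ω = ∑ l, ∑ k ∈ Finset.range (Z n ω l), ξ n l k ω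

/-- The extinction moment `min {n ≥ 1 : Z_k(n) + ... + Z_r(n) = 0}` of the population of the
particles of types `k, ..., r`, equal to `⊤` if there is no such `n`. -/
def extinctionMoment {Ω : Type*} (Z : ℕ → Ω → Fin (M + 1) → ℕ) (k r : Fin (M + 1)) (ω : Ω) : ℕ∞ :=
  ⨅ (n : ℕ) (_ : 1 ≤ n ∧ ∑ l ∈ Finset.Icc k r, Z n ω l = 0), (n : ℕ∞)

/-- `γ_i = 2 ^ (-(N - i))`. -/
def gam (i : Fin (M + 1)) : ℝ := 1 / 2 ^ (M - (i : ℕ))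

/-- `c_{i,N} = (1 / b_N) ^ (1 / 2 ^ (N - i)) *
  ∏_{j = i}^{N - 1} (m_{j,j+1} / b_j) ^ (1 / 2 ^ (j - i + 1))`. -/
def survivalConst (ν : Fin (M + 1) → Measure (Fin (M + 1) → ℕ)) (i : Fin (M + 1)) : ℝ :=
  (1 / halfVar ν (Fin.last M)) ^ ((1 : ℝ) / 2 ^ (M - (i : ℕ))) *
    ∏ j ∈ Finset.univ.filter (fun j : Fin M => i ≤ j.castSucc),
      (meanOffspring ν j.castSucc j.succ / halfVar ν j.castSucc) ^
        ((1 : ℝ) / 2 ^ ((j : ℕ) - (i : ℕ) + 1))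

end DecomposableGW

end

/-! The extinction probabilities of the process are the iterates at `0` of its generating function
`pgf`, so with `Q_i(n) = 1 - F_i^{(n)}(0)` one has `P(T_{iN} = n + 1) = Q_i(n) - Q_i(n + 1)` for
`n ≥ 1` (`HypothesisA.measureReal_extinctionMoment_eq`), and the problem becomes one about the
recursion `1 - Q(n + 1) = F(1 - Q(n))`.

The asymptotics of `Q_i` and of its increments are proved together, by induction from the last type
downwards (`HypothesisA.survivalAsymptotics`). The difference `F_i(s') - F_i(s)` is split exactly
into a mean slope in the critical coordinate `i` times `s'_i - s_i`, and the increment due to the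
coordinates `j > i` (`HypothesisA.pgf_sub_pgf`). Finite second moments and dominated convergence
give the slope to second order (`HypothesisA.tendsto_one_sub_diagSlope`) and the increment to first
order (`HypothesisA.tendsto_tailIncr`).

With `s = 1 - Q(n)` and `s' = 1` this reads
`Q_i(n + 1) = Q_i(n) - b_i (1 + o(1)) Q_i(n) ^ 2 + m_{i,i+1} (1 + o(1)) Q_{i+1}(n)`.
For the last type the third term is absent and `Q_N(n) ~ 1 / (b_N n)`. For the other types the
second and the third term balance, because the left-hand increment is of smaller order: thus
`b_i Q_i(n) ^ 2 ~ m_{i,i+1} Q_{i+1}(n)`, which is the recursion of the constants `c_{i,N}` and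
exponents `γ_i` (`tendsto_mul_rpow_of_quadratic_rec`).

With `s = 1 - Q(n)`, `s' = 1 - Q(n + 1)` and `d_i(n) = Q_i(n) - Q_i(n + 1)` it reads
`d_i(n + 1) = (1 - 2 b_i (1 + o(1)) Q_i(n)) d_i(n) + m_{i,i+1} (1 + o(1)) d_{i+1}(n)`.
As `Q_i(n) ~ c_{i,N} / n ^ γ_i` with `γ_i < 1`, this linear recursion relaxes to its equilibrium
`m_{i,i+1} d_{i+1}(n) / (2 b_i Q_i(n)) ~ γ_i c_{i,N} / n ^ (1 + γ_i)`
(`tendsto_mul_rpow_of_rec`). -/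

namespace DecomposableGW

/-! ### Recursive inequalities and regular decay -/

/-- If `u (n + 1) ≤ (1 - ε n) * u n + ε n * β n`, the sequence moves towards `β n` by the fraction
`ε n` in each step. As `∑ ε n` diverges it forgets its past: `limsup u ≤ lim β`. -/
theorem eventually_le_of_affine_rec {u ε β : ℕ → ℝ} {ℓ : ℝ}
    (hrec : ∀ᶠ n in atTop, u (n + 1) ≤ (1 - ε n) * u n + ε n * β n)
    (hε0 : ∀ᶠ n in atTop, 0 ≤ ε n) (hε1 : ∀ᶠ n in atTop, ε n ≤ 1) (hsum : ¬ Summable ε)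
    (hβ : Tendsto β atTop (𝓝 ℓ)) {δ : ℝ} (hδ : 0 < δ) :
    ∀ᶠ n in atTop, u n ≤ ℓ + δ := by
  have hβ' : ∀ᶠ n in atTop, β n ≤ ℓ + δ / 2 := hβ.eventually_le_const (by linarith)
  obtain ⟨N, hN⟩ := eventually_atTop.1 (hrec.and (hε0.and (hε1.and hβ')))
  set W := max (u N - (ℓ + δ / 2)) 0 with hW
  -- Above level `ℓ + δ / 2` the excess contracts by `1 - ε ≤ exp (-ε)` at every step.
  have hbound : ∀ k, u (N + k) - (ℓ + δ / 2) ≤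
      Real.exp (-∑ j ∈ Finset.range k, ε (N + j)) * W := by
    intro k
    induction k with
    | zero => simp [hW]
    | succ k ih =>
      obtain ⟨h1, h2, h3, h4⟩ := hN (N + k) (by omega)
      have hexp : 1 - ε (N + k) ≤ Real.exp (-ε (N + k)) := by
        linarith [Real.add_one_le_exp (-ε (N + k))]
      have hpos : 0 ≤ Real.exp (-∑ j ∈ Finset.range k, ε (N + j)) * W := by positivity
      calc u (N + (k + 1)) - (ℓ + δ / 2)
          ≤ (1 - ε (N + k)) * (u (N + k) - (ℓ + δ / 2)) := by
            have := mul_le_mul_of_nonneg_left h4 h2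
            rw [← add_assoc]; linarith
        _ ≤ (1 - ε (N + k)) * (Real.exp (-∑ j ∈ Finset.range k, ε (N + j)) * W) :=
            mul_le_mul_of_nonneg_left ih (by linarith)
        _ ≤ Real.exp (-ε (N + k)) * (Real.exp (-∑ j ∈ Finset.range k, ε (N + j)) * W) :=
            mul_le_mul_of_nonneg_right hexp hpos
        _ = _ := by rw [← mul_assoc, ← Real.exp_add, Finset.sum_range_succ]; ring_nf
  have hdiv : Tendsto (fun k => ∑ j ∈ Finset.range k, ε (N + j)) atTop atTop := by
    refine (not_summable_iff_tendsto_nat_atTop_of_nonneg fun j => (hN (N + j) (by omega)).2.1).1 ?_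
    simpa only [add_comm N] using fun h => hsum ((summable_nat_add_iff N).1 h)
  have hlim : Tendsto (fun k => Real.exp (-∑ j ∈ Finset.range k, ε (N + j)) * W) atTop (𝓝 0) := by
    simpa using (Real.tendsto_exp_neg_atTop_nhds_zero.comp hdiv).mul_const W
  obtain ⟨K, hK⟩ := eventually_atTop.1 (hlim.eventually_le_const (half_pos hδ))
  refine eventually_atTop.2 ⟨N + K, fun n hn => ?_⟩
  obtain ⟨k, rfl⟩ := Nat.exists_eq_add_of_le (le_trans (Nat.le_add_right N K) hn)
  linarith [hbound k, hK k (by omega)]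

theorem tendsto_succ_div_rpow_sub_one (ρ : ℝ) {γ : ℝ} (hγ : γ < 1) :
    Tendsto (fun n : ℕ => ((((n + 1 : ℕ) : ℝ) / n) ^ ρ - 1) * (n : ℝ) ^ γ) atTop (𝓝 0) := by
  have hder : HasDerivAt (fun x : ℝ => (1 + x) ^ ρ) ρ 0 := by
    have := ((hasDerivAt_id (0 : ℝ)).const_add 1).rpow_const (p := ρ) (Or.inl (by simp))
    simpa using this
  have h1 := hder.tendsto_slope_zero
  have h2 : Tendsto (fun n : ℕ => ((n : ℝ))⁻¹) atTop (𝓝[≠] 0) :=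
    tendsto_nhdsWithin_iff.2 ⟨tendsto_inv_atTop_nhds_zero_nat,
      (eventually_gt_atTop 0).mono fun n hn => by simpa using hn.ne'⟩
  have h3 : Tendsto (fun n : ℕ => (n : ℝ) ^ (-(1 - γ))) atTop (𝓝 0) :=
    (tendsto_rpow_neg_atTop (by linarith : 0 < 1 - γ)).comp tendsto_natCast_atTop_atTop
  have h4 := (h1.comp h2).mul h3
  rw [mul_zero] at h4
  refine h4.congr' ((eventually_gt_atTop 0).mono fun n hn => ?_)
  have hn' : (0 : ℝ) < n := by exact_mod_cast hn
  have e1 : (n : ℝ) ^ (-(1 - γ)) = (n : ℝ) ^ γ / n := by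
    rw [show -(1 - γ) = γ - 1 by ring, Real.rpow_sub_one hn'.ne']
  have e2 : 1 + (n : ℝ)⁻¹ = ((n + 1 : ℕ) : ℝ) / n := by push_cast; field_simp
  simp only [Function.comp, e1, smul_eq_mul, inv_inv, zero_add, add_zero, Real.one_rpow, e2]
  field_simp

theorem tendsto_succ_div_rpow (ρ : ℝ) :
    Tendsto (fun n : ℕ => (((n + 1 : ℕ) : ℝ) / n) ^ ρ) atTop (𝓝 1) := by
  simpa using (tendsto_succ_div_rpow_sub_one ρ zero_lt_one).add_const 1

theorem not_summable_of_tendsto_mul_rpow {ε : ℕ → ℝ} {γ α : ℝ} (hγ : γ < 1) (hα : 0 < α)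
    (h : Tendsto (fun n => ε n * (n : ℝ) ^ γ) atTop (𝓝 α)) : ¬ Summable ε := by
  intro hs
  have hO : (fun n : ℕ => 1 / (n : ℝ) ^ γ) =O[atTop] ε := by
    refine Asymptotics.IsBigO.of_bound (2 / α) ?_
    filter_upwards [h.eventually_const_le (half_lt_self hα), eventually_gt_atTop 0] with n h1 hn
    have hn' : (0 : ℝ) < (n : ℝ) ^ γ := by positivity
    have hε : 0 < ε n := by
      by_contra hc
      nlinarith
    rw [Real.norm_of_nonneg (by positivity), Real.norm_of_nonneg hε.le, div_le_iff₀ hn',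
      div_mul_eq_mul_div, div_mul_eq_mul_div, le_div_iff₀ hα]
    linarith
  exact absurd (Real.summable_one_div_nat_rpow.1 (summable_of_isBigO_nat hs hO)) (by linarith)

/-- Quasi-stationary bound for `d (n + 1) ≤ (1 - e n) * d n + s n` with a contraction rate
`e n ~ α / n ^ γ` that dominates `1 / n`: asymptotically `d n` is at most the equilibrium
`s n / e n ~ (σ / α) / n ^ ρ`. -/
theorem eventually_mul_rpow_le_of_rec {d e s : ℕ → ℝ} {γ ρ α σ : ℝ} (hγ0 : 0 < γ) (hγ1 : γ < 1)
    (hα : 0 < α) (hrec : ∀ᶠ n in atTop, d (n + 1) ≤ (1 - e n) * d n + s n)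
    (he : Tendsto (fun n => e n * (n : ℝ) ^ γ) atTop (𝓝 α))
    (hs : Tendsto (fun n => s n * (n : ℝ) ^ (ρ + γ)) atTop (𝓝 σ)) {δ : ℝ} (hδ : 0 < δ) :
    ∀ᶠ n : ℕ in atTop, d n * (n : ℝ) ^ ρ ≤ σ / α + δ := by
  set r : ℕ → ℝ := fun n => (((n + 1 : ℕ) : ℝ) / n) ^ ρ with hr
  have hr1 : Tendsto r atTop (𝓝 1) := tendsto_succ_div_rpow ρ
  have hr0 := tendsto_succ_div_rpow_sub_one ρ hγ1
  -- `ε n` is the contraction rate of `d n * n ^ ρ`; it differs from `e n` by `O(1 / n)`, which is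
  -- negligible because `γ < 1`.
  set ε : ℕ → ℝ := fun n => 1 - (1 - e n) * r n with hε
  have hεlim : Tendsto (fun n => ε n * (n : ℝ) ^ γ) atTop (𝓝 α) := by
    have := (he.mul hr1).sub hr0
    rw [mul_one, sub_zero] at this
    refine this.congr fun n => ?_
    simp only [hε, hr]; ring
  have hpos : ∀ᶠ n in atTop, 0 < ε n := by
    filter_upwards [hεlim.eventually_const_lt hα] with n h1
    exact pos_of_mul_pos_left h1 (by positivity)
  have hε0 : Tendsto ε atTop (𝓝 0) := by
    have h3 : Tendsto (fun n : ℕ => (n : ℝ) ^ (-γ)) atTop (𝓝 0) :=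
      (tendsto_rpow_neg_atTop hγ0).comp tendsto_natCast_atTop_atTop
    have := hεlim.mul h3
    rw [mul_zero] at this
    refine this.congr' ((eventually_gt_atTop 0).mono fun n hn => ?_)
    have hn' : (0 : ℝ) < n := by exact_mod_cast hn
    rw [mul_assoc, ← Real.rpow_add hn']; simp
  have hβ : Tendsto (fun n => s n * ((n + 1 : ℕ) : ℝ) ^ ρ / ε n) atTop (𝓝 (σ / α)) := by
    have := (hs.mul hr1).div hεlim hα.ne'
    rw [mul_one] at this
    refine this.congr' ?_
    filter_upwards [eventually_gt_atTop 0, hpos] with n hn hp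
    have hn' : (0 : ℝ) < n := by exact_mod_cast hn
    simp only [hr, Pi.div_apply]
    rw [Real.div_rpow (by positivity) (by positivity), Real.rpow_add hn']
    have h1 := (Real.rpow_pos_of_pos hn' γ).ne'
    have h2 := (Real.rpow_pos_of_pos hn' ρ).ne'
    field_simp
  refine eventually_le_of_affine_rec (u := fun n => d n * (n : ℝ) ^ ρ) (ε := ε) ?_
    (hpos.mono fun _ h => h.le) (hε0.eventually_le_const one_pos)
    (not_summable_of_tendsto_mul_rpow hγ1 hα hεlim) hβ hδ
  filter_upwards [hrec, eventually_gt_atTop 0, hpos] with n h1 hn hp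
  have hn' : (0 : ℝ) < n := by exact_mod_cast hn
  have e1 : (((n + 1 : ℕ) : ℝ)) ^ ρ = r n * (n : ℝ) ^ ρ := by
    simp only [hr]
    rw [Real.div_rpow (by positivity) (by positivity), div_mul_cancel₀ _ (by positivity)]
  rw [mul_div_cancel₀ _ hp.ne']
  calc d (n + 1) * ((n + 1 : ℕ) : ℝ) ^ ρ
      ≤ ((1 - e n) * d n + s n) * ((n + 1 : ℕ) : ℝ) ^ ρ :=
        mul_le_mul_of_nonneg_right h1 (by positivity)
    _ = (1 - ε n) * (d n * (n : ℝ) ^ ρ) + s n * ((n + 1 : ℕ) : ℝ) ^ ρ := by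
        rw [add_mul]; congr 1; rw [e1]; simp only [hε]; ring

/-- The lower counterpart of `eventually_mul_rpow_le_of_rec`. -/
theorem eventually_le_mul_rpow_of_rec {d e s : ℕ → ℝ} {γ ρ α σ : ℝ} (hγ0 : 0 < γ) (hγ1 : γ < 1)
    (hα : 0 < α) (hrec : ∀ᶠ n in atTop, (1 - e n) * d n + s n ≤ d (n + 1))
    (he : Tendsto (fun n => e n * (n : ℝ) ^ γ) atTop (𝓝 α))
    (hs : Tendsto (fun n => s n * (n : ℝ) ^ (ρ + γ)) atTop (𝓝 σ)) {δ : ℝ} (hδ : 0 < δ) :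
    ∀ᶠ n : ℕ in atTop, σ / α - δ ≤ d n * (n : ℝ) ^ ρ := by
  have := eventually_mul_rpow_le_of_rec (d := fun n => -d n) (e := e) (s := fun n => -s n)
    (σ := -σ) (ρ := ρ) hγ0 hγ1 hα (hrec.mono fun n h => by linarith) he
    (by simpa [neg_mul] using hs.neg) hδ
  filter_upwards [this] with n h
  rw [neg_div, neg_mul] at h
  linarith

theorem tendsto_of_eventually_bounds {u : ℕ → ℝ} {ℓ : ℝ}
    (h1 : ∀ δ > 0, ∀ᶠ n in atTop, u n ≤ ℓ + δ) (h2 : ∀ δ > 0, ∀ᶠ n in atTop, ℓ - δ ≤ u n) :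
    Tendsto u atTop (𝓝 ℓ) := by
  refine Metric.tendsto_nhds.2 fun δ hδ => ?_
  filter_upwards [h1 _ (half_pos hδ), h2 _ (half_pos hδ)] with n a b
  rw [Real.dist_eq, abs_lt]
  constructor <;> linarith

theorem tendsto_mul_rpow_of_rec {d e s : ℕ → ℝ} {γ ρ α σ : ℝ} (hγ0 : 0 < γ) (hγ1 : γ < 1)
    (hα : 0 < α) (hrec : ∀ n, d (n + 1) = (1 - e n) * d n + s n)
    (he : Tendsto (fun n => e n * (n : ℝ) ^ γ) atTop (𝓝 α))
    (hs : Tendsto (fun n => s n * (n : ℝ) ^ (ρ + γ)) atTop (𝓝 σ)) :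
    Tendsto (fun n => d n * (n : ℝ) ^ ρ) atTop (𝓝 (σ / α)) :=
  tendsto_of_eventually_bounds
    (fun _ hδ => eventually_mul_rpow_le_of_rec hγ0 hγ1 hα
      (.of_forall fun n => (hrec n).le) he hs hδ)
    (fun _ hδ => eventually_le_mul_rpow_of_rec hγ0 hγ1 hα
      (.of_forall fun n => (hrec n).ge) he hs hδ)

/-- If `q (n + 1) = q n - A n * q n ^ 2 + g n` with `A → b` and `g n ~ b * (c / n ^ γ) ^ 2`, then
`q n ~ c / n ^ γ`: the two last terms have to balance, since the decay `c / n ^ γ` has increments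
of the smaller order `n ^ (-1 - γ)`. -/
theorem tendsto_mul_rpow_of_quadratic_rec {q A g : ℕ → ℝ} {γ b c : ℝ} (hγ0 : 0 < γ) (hγ1 : γ < 1)
    (hb : 0 < b) (hc : 0 < c) (hq : ∀ n, 0 ≤ q n)
    (hrec : ∀ n, q (n + 1) = q n - A n * q n ^ 2 + g n) (hA : Tendsto A atTop (𝓝 b))
    (hg : Tendsto (fun n => g n * (n : ℝ) ^ (γ + γ)) atTop (𝓝 (b * c ^ 2))) :
    Tendsto (fun n => q n * (n : ℝ) ^ γ) atTop (𝓝 c) := by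
  have hApos : ∀ᶠ n in atTop, 0 ≤ A n := hA.eventually_const_le hb
  have hcancel : ∀ᶠ n : ℕ in atTop, (n : ℝ) ^ (-γ) * (n : ℝ) ^ γ = 1 := by
    filter_upwards [eventually_gt_atTop 0] with n hn
    have hn' : (0 : ℝ) < n := by exact_mod_cast hn
    rw [← Real.rpow_add hn']; simp
  have hdbl : ∀ᶠ n : ℕ in atTop, (n : ℝ) ^ (γ + γ) = (n : ℝ) ^ γ * (n : ℝ) ^ γ := by
    filter_upwards [eventually_gt_atTop 0] with n hn
    have hn' : (0 : ℝ) < n := by exact_mod_cast hn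
    rw [← Real.rpow_add hn']
  -- The tangent inequality `q ^ 2 ≥ 2 * y * q - y ^ 2` at `y = c / n ^ γ` makes it affine.
  have hupper : ∀ δ > 0, ∀ᶠ n : ℕ in atTop, q n * (n : ℝ) ^ γ ≤ c + δ := by
    intro δ hδ
    have key := eventually_mul_rpow_le_of_rec (d := q) (ρ := γ)
      (e := fun n => 2 * c * A n * (n : ℝ) ^ (-γ))
      (s := fun n => A n * c ^ 2 * ((n : ℝ) ^ (-γ)) ^ 2 + g n) (α := 2 * c * b)
      (σ := b * c ^ 2 + b * c ^ 2) hγ0 hγ1 (by positivity) ?_ ?_ ?_ hδ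
    · have e : (b * c ^ 2 + b * c ^ 2) / (2 * c * b) = c := by field_simp; ring
      rwa [e] at key
    · filter_upwards [hApos] with n hAn
      rw [hrec n]
      nlinarith [mul_nonneg hAn (sq_nonneg (q n - c * (n : ℝ) ^ (-γ)))]
    · refine (hA.const_mul (2 * c)).congr' ?_
      filter_upwards [hcancel] with n h1
      rw [mul_assoc _ ((n : ℝ) ^ (-γ)), h1, mul_one]
    · refine ((hA.mul_const (c ^ 2)).add hg).congr' ?_
      filter_upwards [hcancel, hdbl] with n h1 h2
      rw [add_mul, h2]
      congr 1
      linear_combination (-(A n * c ^ 2) * ((n : ℝ) ^ (-γ) * (n : ℝ) ^ γ + 1)) * h1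
  refine tendsto_of_eventually_bounds hupper fun δ hδ => ?_
  -- Conversely, `q ^ 2 ≤ (c + δ / 2) / n ^ γ * q` by the upper bound, and `c ^ 2 / (c + δ / 2)` is
  -- close to `c`.
  have hlow := eventually_le_mul_rpow_of_rec (d := q) (ρ := γ)
      (e := fun n => (c + δ / 2) * A n * (n : ℝ) ^ (-γ)) (s := g) (α := (c + δ / 2) * b)
      (σ := b * c ^ 2) hγ0 hγ1 (by positivity) ?_ ?_ hg (half_pos hδ)
  · filter_upwards [hlow] with n hn
    refine le_trans ?_ hn
    have : c - δ / 2 ≤ b * c ^ 2 / ((c + δ / 2) * b) := by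
      rw [le_div_iff₀ (by positivity)]
      nlinarith [mul_nonneg hb.le (sq_nonneg δ)]
    linarith
  · filter_upwards [hApos, hupper _ (half_pos hδ), hcancel] with n hAn h1 h2
    rw [hrec n]
    have h3 : q n ≤ (c + δ / 2) * (n : ℝ) ^ (-γ) := by
      have := mul_le_mul_of_nonneg_right h1 (by positivity : 0 ≤ (n : ℝ) ^ (-γ))
      rwa [mul_assoc, mul_comm ((n : ℝ) ^ γ), h2, mul_one] at this
    nlinarith [mul_le_mul_of_nonneg_left h3 (mul_nonneg hAn (hq n))]
  · refine (hA.const_mul (c + δ / 2)).congr' ?_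
    filter_upwards [hcancel] with n h1
    rw [mul_assoc _ ((n : ℝ) ^ (-γ)), h1, mul_one]

/-- If `q (n + 1) = q n - A n * q n ^ 2` with `A → b` and `q → 0`, then `q n ~ 1 / (b n)`, since
the increments of `1 / q` tend to `b`. -/
theorem tendsto_natCast_mul_of_quadratic_rec {q A : ℕ → ℝ} {b : ℝ} (hb : 0 < b)
    (hq : ∀ n, 0 < q n) (hq0 : Tendsto q atTop (𝓝 0))
    (hrec : ∀ n, q (n + 1) = q n - A n * q n ^ 2) (hA : Tendsto A atTop (𝓝 b)) :
    Tendsto (fun n => q n * (n : ℝ)) atTop (𝓝 (1 / b)) := by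
  have hinc : ∀ n, 1 / q (n + 1) - 1 / q n = A n / (1 - A n * q n) := by
    intro n
    have h1 := hq n
    have h2 := hq (n + 1)
    have h3 : q (n + 1) = q n * (1 - A n * q n) := by rw [hrec]; ring
    have h4 : 1 - A n * q n ≠ 0 := by
      intro h; rw [h, mul_zero] at h3; exact h2.ne' h3
    rw [h3, div_sub_div _ _ (mul_ne_zero h1.ne' h4) h1.ne',
      div_eq_div_iff (mul_ne_zero (mul_ne_zero h1.ne' h4) h1.ne') h4]
    ring
  have hlim : Tendsto (fun n => 1 / q (n + 1) - 1 / q n) atTop (𝓝 b) := by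
    simp only [hinc]
    have := hA.div ((hA.mul hq0).const_sub 1) (by simp)
    rwa [mul_zero, sub_zero, div_one] at this
  have hces := hlim.cesaro
  simp only [Finset.sum_range_sub (fun n => 1 / q n)] at hces
  have h5 : Tendsto (fun n : ℕ => (n : ℝ)⁻¹ * (1 / q n)) atTop (𝓝 b) := by
    have := hces.add (tendsto_inv_atTop_nhds_zero_nat.mul_const (1 / q 0))
    simp only [zero_mul, add_zero] at this
    refine this.congr fun n => ?_
    ring
  have h6 := h5.inv₀ hb.ne'
  rw [← one_div] at h6
  refine h6.congr fun n => ?_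
  simp [mul_comm]

/-! ### Monomials near the point `1` -/

theorem pow_sub_pow_le_mul {x y : ℝ} (hx : 0 ≤ x) (hxy : x ≤ y) (hy : y ≤ 1) (k : ℕ) :
    y ^ k - x ^ k ≤ k * (y - x) := by
  induction k with
  | zero => simp
  | succ k ih =>
    have h1 : y ^ k ≤ 1 := pow_le_one₀ (hx.trans hxy) hy
    have h3 : 0 ≤ y ^ k - x ^ k := sub_nonneg.2 (pow_le_pow_left₀ hx hxy k)
    have h4 : x * (y ^ k - x ^ k) ≤ y ^ k - x ^ k := mul_le_of_le_one_left h3 (hxy.trans hy)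
    have h5 : (y - x) * y ^ k ≤ y - x := mul_le_of_le_one_right (by linarith) h1
    push_cast
    linarith [show y ^ (k + 1) - x ^ (k + 1) = (y - x) * y ^ k + x * (y ^ k - x ^ k) by ring]

section Monomials

variable {ι : Type*}

theorem prod_pow_mem_Icc {s : ι → ℝ} (h0 : ∀ j, 0 ≤ s j) (h1 : ∀ j, s j ≤ 1) (S : Finset ι)
    (k : ι → ℕ) : ∏ j ∈ S, s j ^ k j ∈ Set.Icc (0 : ℝ) 1 :=
  ⟨Finset.prod_nonneg fun j _ => pow_nonneg (h0 j) _,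
    Finset.prod_le_one (fun j _ => pow_nonneg (h0 j) _) fun j _ => pow_le_one₀ (h0 j) (h1 j)⟩

theorem prod_pow_le_prod_pow {s s' : ι → ℝ} (h0 : ∀ j, 0 ≤ s j) (hss : ∀ j, s j ≤ s' j)
    (S : Finset ι) (k : ι → ℕ) : ∏ j ∈ S, s j ^ k j ≤ ∏ j ∈ S, s' j ^ k j :=
  Finset.prod_le_prod (fun j _ => pow_nonneg (h0 j) _) fun j _ => pow_le_pow_left₀ (h0 j) (hss j) _

theorem prod_pow_sub_prod_pow_le {s s' : ι → ℝ} (h0 : ∀ j, 0 ≤ s j) (hss : ∀ j, s j ≤ s' j)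
    (h1 : ∀ j, s' j ≤ 1) (S : Finset ι) (k : ι → ℕ) :
    ∏ j ∈ S, s' j ^ k j - ∏ j ∈ S, s j ^ k j ≤ ∑ j ∈ S, k j * (s' j - s j) := by
  classical
  induction S using Finset.induction_on with
  | empty => simp
  | insert p S hp ih =>
    rw [Finset.prod_insert hp, Finset.prod_insert hp, Finset.sum_insert hp]
    obtain ⟨-, hA1⟩ := prod_pow_mem_Icc (fun j => (h0 j).trans (hss j)) h1 S k
    have hAA := prod_pow_le_prod_pow h0 hss S k
    have ha := pow_sub_pow_le_mul (h0 p) (hss p) (h1 p) (k p)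
    have haa : s p ^ k p ≤ s' p ^ k p := pow_le_pow_left₀ (h0 p) (hss p) _
    have ha1 : s p ^ k p ≤ 1 := pow_le_one₀ (h0 p) ((hss p).trans (h1 p))
    have h2 := mul_le_of_le_one_right (sub_nonneg.2 haa) hA1
    have h3 := mul_le_of_le_one_left (sub_nonneg.2 hAA) ha1
    linarith

/-- Weighted differences satisfy the Leibniz rule near `1`. The weight `w` plays the role of the
inverse of the scale on which the differences are measured. -/
theorem tendsto_mul_sub_mul {a a' b b' w : ℕ → ℝ} {α β : ℝ} (ha : Tendsto a atTop (𝓝 1))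
    (hb' : Tendsto b' atTop (𝓝 1)) (h1 : Tendsto (fun n => (a' n - a n) * w n) atTop (𝓝 α))
    (h2 : Tendsto (fun n => (b' n - b n) * w n) atTop (𝓝 β)) :
    Tendsto (fun n => (a' n * b' n - a n * b n) * w n) atTop (𝓝 (α + β)) := by
  have := (h1.mul hb').add (ha.mul h2)
  rw [mul_one, one_mul] at this
  exact this.congr fun n => by ring

theorem tendsto_pow_sub_pow {x y w : ℕ → ℝ} {ρ : ℝ} (hx : Tendsto x atTop (𝓝 1))
    (hy : Tendsto y atTop (𝓝 1)) (h : Tendsto (fun n => (y n - x n) * w n) atTop (𝓝 ρ)) (k : ℕ) :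
    Tendsto (fun n => (y n ^ k - x n ^ k) * w n) atTop (𝓝 (k * ρ)) := by
  induction k with
  | zero => simp
  | succ k ih =>
    have := tendsto_mul_sub_mul (by simpa using hx.pow k) hy ih h
    simpa [pow_succ, add_mul] using this

theorem tendsto_prod_pow_sub_prod_pow {s s' : ℕ → ι → ℝ} {w : ℕ → ℝ} {ρ : ι → ℝ} {S : Finset ι}
    (hs : ∀ j ∈ S, Tendsto (fun n => s n j) atTop (𝓝 1))
    (hs' : ∀ j ∈ S, Tendsto (fun n => s' n j) atTop (𝓝 1))
    (h : ∀ j ∈ S, Tendsto (fun n => (s' n j - s n j) * w n) atTop (𝓝 (ρ j))) (k : ι → ℕ) :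
    Tendsto (fun n => (∏ j ∈ S, s' n j ^ k j - ∏ j ∈ S, s n j ^ k j) * w n) atTop
      (𝓝 (∑ j ∈ S, k j * ρ j)) := by
  classical
  induction S using Finset.induction_on with
  | empty => simp
  | insert p S hp ih =>
    simp only [Finset.prod_insert hp, Finset.sum_insert hp]
    have hS := ih (fun j hj => hs j (Finset.mem_insert_of_mem hj))
      (fun j hj => hs' j (Finset.mem_insert_of_mem hj))
      (fun j hj => h j (Finset.mem_insert_of_mem hj))
    have hp' := Finset.mem_insert_self p S
    refine tendsto_mul_sub_mul (by simpa using (hs p hp').pow (k p)) ?_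
      (tendsto_pow_sub_pow (hs p hp') (hs' p hp') (h p hp') (k p)) hS
    simpa using tendsto_finsetProd S
      fun j hj => (hs' j (Finset.mem_insert_of_mem hj)).pow (k j)

end Monomials

noncomputable section

section GeneratingFunctions

/-! ### Offspring generating functions near the point `1` -/

variable {M : ℕ}

/-- The probability generating function of the offspring vector of a type `l` particle; `pgf ν` is
regarded as a self-map of `Fin (M + 1) → ℝ`, so that generations correspond to its iterates. -/
def pgf (ν : Fin (M + 1) → Measure (Fin (M + 1) → ℕ)) (s : Fin (M + 1) → ℝ) (l : Fin (M + 1)) : ℝ :=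
  ∫ k, ∏ j, s j ^ k j ∂(ν l)

/-- The mean slope of `pgf ν · i` in its own coordinate `i` between `s i` and `s' i`, the later
coordinates being held at `s'`. The difference quotient of `x ↦ x ^ k` is written as a geometric
sum, so that it is meaningful for `s i = s' i` too. Coordinates `j < i` are left out, as a type `i`
particle has no children of such types. -/
def diagSlope (ν : Fin (M + 1) → Measure (Fin (M + 1) → ℕ)) (i : Fin (M + 1))
    (s s' : Fin (M + 1) → ℝ) : ℝ :=
  ∫ k, (∑ a ∈ Finset.range (k i), s' i ^ a * s i ^ (k i - 1 - a)) *
    ∏ j ∈ Finset.Ioi i, s' j ^ k j ∂(ν i)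

/-- The increment of `pgf ν · i` when the coordinates `j > i` move from `s` to `s'`, coordinate `i`
being held at `s i`. -/
def tailIncr (ν : Fin (M + 1) → Measure (Fin (M + 1) → ℕ)) (i : Fin (M + 1))
    (s s' : Fin (M + 1) → ℝ) : ℝ :=
  ∫ k, s i ^ k i * (∏ j ∈ Finset.Ioi i, s' j ^ k j - ∏ j ∈ Finset.Ioi i, s j ^ k j) ∂(ν i)

theorem integrable_of_mem_Icc {α : Type*} [MeasurableSpace α] {μ : Measure α} [IsFiniteMeasure μ]
    {f : α → ℝ} (hf : Measurable f) (h : ∀ x, f x ∈ Set.Icc (0 : ℝ) 1) : Integrable f μ :=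
  Integrable.of_bound hf.aestronglyMeasurable 1 (.of_forall fun x => by
    rw [Real.norm_of_nonneg (h x).1]; exact (h x).2)

variable {ν : Fin (M + 1) → Measure (Fin (M + 1) → ℕ)}

theorem HypothesisA.integrable_coord (hA : HypothesisA ν) {i j : Fin (M + 1)} (hj : i ≤ j) :
    Integrable (fun x : Fin (M + 1) → ℕ => (x j : ℝ)) (ν i) := by
  refine (hA.secondMoments _ _ _ hj hj).mono' (Measurable.of_discrete).aestronglyMeasurable
    (.of_forall fun x => ?_)
  rw [Real.norm_of_nonneg (by positivity)]
  exact_mod_cast Nat.le_mul_self (x j)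

theorem HypothesisA.prod_eq (hA : HypothesisA ν) (i : Fin (M + 1)) (s : Fin (M + 1) → ℝ) :
    ∀ᵐ k ∂(ν i), ∏ j, s j ^ k j = s i ^ k i * ∏ j ∈ Finset.Ioi i, s j ^ k j := by
  have h : ∀ᵐ k ∂(ν i), ∀ j, j < i → k j = 0 := by
    rw [ae_all_iff]; intro j
    by_cases hj : j < i
    · filter_upwards [hA.decomposable i j hj] with k hk _ using hk
    · exact .of_forall fun k h => absurd h hj
  filter_upwards [h] with k hk
  rw [← Finset.prod_insert (f := fun j => s j ^ k j) Finset.notMem_Ioi_self, Finset.Ioi_insert]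
  refine (Finset.prod_subset (fun j _ => Finset.mem_univ j) fun j _ hj => ?_).symm
  rw [hk j (not_le.1 fun h => hj (Finset.mem_Ici.2 h)), pow_zero]

theorem HypothesisA.pgf_eq (hA : HypothesisA ν) (i : Fin (M + 1)) (s : Fin (M + 1) → ℝ) :
    pgf ν s i = ∫ k, s i ^ k i * ∏ j ∈ Finset.Ioi i, s j ^ k j ∂(ν i) :=
  integral_congr_ae (hA.prod_eq i s)

theorem geom_sum₂_mem_Icc {x y : ℝ} (hx0 : 0 ≤ x) (hx1 : x ≤ 1) (hy0 : 0 ≤ y) (hy1 : y ≤ 1)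
    (k : ℕ) : ∑ a ∈ Finset.range k, y ^ a * x ^ (k - 1 - a) ∈ Set.Icc (0 : ℝ) k := by
  refine ⟨Finset.sum_nonneg fun a _ => by positivity, ?_⟩
  calc ∑ a ∈ Finset.range k, y ^ a * x ^ (k - 1 - a)
      ≤ ∑ a ∈ Finset.range k, (1 : ℝ) := Finset.sum_le_sum fun a _ =>
        mul_le_one₀ (pow_le_one₀ hy0 hy1) (pow_nonneg hx0 _) (pow_le_one₀ hx0 hx1)
    _ = k := by simp

theorem HypothesisA.integrable_diagSlope (hA : HypothesisA ν) (i : Fin (M + 1))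
    {s s' : Fin (M + 1) → ℝ} (h0 : ∀ j, 0 ≤ s j) (hss : ∀ j, s j ≤ s' j) (h1 : ∀ j, s' j ≤ 1) :
    Integrable (fun k : Fin (M + 1) → ℕ =>
      (∑ a ∈ Finset.range (k i), s' i ^ a * s i ^ (k i - 1 - a)) *
        ∏ j ∈ Finset.Ioi i, s' j ^ k j) (ν i) := by
  refine (hA.integrable_coord (le_refl i)).mono' (Measurable.of_discrete).aestronglyMeasurable
    (.of_forall fun k => ?_)
  have h2 := geom_sum₂_mem_Icc (h0 i) ((hss i).trans (h1 i)) ((h0 i).trans (hss i)) (h1 i) (k i)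
  have h3 := prod_pow_mem_Icc (fun j => (h0 j).trans (hss j)) h1 (Finset.Ioi i) k
  rw [Real.norm_of_nonneg (mul_nonneg h2.1 h3.1)]
  exact (mul_le_of_le_one_right h2.1 h3.2).trans h2.2

/-- First-order behaviour of `tailIncr` near `s = 1`, with the increments of the coordinates
measured on the scale `1 / w`. By dominated convergence, with dominating function a linear
combination of the offspring numbers. -/
theorem HypothesisA.tendsto_tailIncr (hA : HypothesisA ν) (i : Fin (M + 1))
    {s s' : ℕ → Fin (M + 1) → ℝ} {w : ℕ → ℝ} {ρ : Fin (M + 1) → ℝ} (h0 : ∀ n j, 0 ≤ s n j)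
    (hss : ∀ n j, s n j ≤ s' n j) (h1 : ∀ n j, s' n j ≤ 1) (hw : ∀ n, 0 ≤ w n)
    (hs : ∀ j, i ≤ j → Tendsto (fun n => s n j) atTop (𝓝 1))
    (h : ∀ j, i < j → Tendsto (fun n => (s' n j - s n j) * w n) atTop (𝓝 (ρ j))) :
    Tendsto (fun n => tailIncr ν i (s n) (s' n) * w n) atTop
      (𝓝 (∑ j ∈ Finset.Ioi i, meanOffspring ν i j * ρ j)) := by
  have hs' : ∀ j, i ≤ j → Tendsto (fun n => s' n j) atTop (𝓝 1) := fun j hj =>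
    tendsto_of_tendsto_of_tendsto_of_le_of_le (hs j hj) tendsto_const_nhds
      (fun n => hss n j) (fun n => h1 n j)
  have hρ : ∀ᶠ n in atTop, ∀ j, i < j → (s' n j - s n j) * w n ≤ ρ j + 1 := by
    rw [eventually_all]; intro j
    by_cases hj : i < j
    · filter_upwards [(h j hj).eventually_le_const (lt_add_one _)] with n hn _ using hn
    · exact .of_forall fun n h => absurd h hj
  have hlim : ∑ j ∈ Finset.Ioi i, meanOffspring ν i j * ρ j =
      ∫ k, ∑ j ∈ Finset.Ioi i, (k j : ℝ) * ρ j ∂(ν i) := by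
    rw [integral_finsetSum _ fun j hj =>
      (hA.integrable_coord (Finset.mem_Ioi.1 hj).le).mul_const _]
    simp only [integral_mul_const, meanOffspring]
  rw [hlim]
  simp only [tailIncr, ← integral_mul_const]
  refine tendsto_integral_filter_of_dominated_convergence
    (fun k => ∑ j ∈ Finset.Ioi i, (k j : ℝ) * (ρ j + 1))
    (.of_forall fun n => (Measurable.of_discrete).aestronglyMeasurable) ?_
    (integrable_finsetSum _ fun j hj =>
      (hA.integrable_coord (Finset.mem_Ioi.1 hj).le).mul_const _) (.of_forall fun k => ?_)
  · filter_upwards [hρ] with n hn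
    refine .of_forall fun k => ?_
    have e1 := prod_pow_le_prod_pow (h0 n) (hss n) (Finset.Ioi i) k
    have e2 := prod_pow_sub_prod_pow_le (h0 n) (hss n) (h1 n) (Finset.Ioi i) k
    have e3 : s n i ^ k i ≤ 1 := pow_le_one₀ (h0 n i) ((hss n i).trans (h1 n i))
    rw [Real.norm_of_nonneg (mul_nonneg (mul_nonneg (pow_nonneg (h0 n i) _) (sub_nonneg.2 e1))
      (hw n))]
    calc _ ≤ (∑ j ∈ Finset.Ioi i, (k j : ℝ) * (s' n j - s n j)) * w n :=
          mul_le_mul_of_nonneg_right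
            ((mul_le_of_le_one_left (sub_nonneg.2 e1) e3).trans e2) (hw n)
      _ ≤ _ := by
        rw [Finset.sum_mul]
        refine Finset.sum_le_sum fun j hj => ?_
        rw [mul_assoc]
        exact mul_le_mul_of_nonneg_left (hn j (Finset.mem_Ioi.1 hj)) (by positivity)
  · have e1 : Tendsto (fun n => s n i ^ k i) atTop (𝓝 1) := by simpa using (hs i le_rfl).pow (k i)
    have e2 := e1.mul (tendsto_prod_pow_sub_prod_pow (w := w) (ρ := ρ) (S := Finset.Ioi i)
      (fun j hj => hs j (Finset.mem_Ioi.1 hj).le) (fun j hj => hs' j (Finset.mem_Ioi.1 hj).le)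
      (fun j hj => h j (Finset.mem_Ioi.1 hj)) k)
    rw [one_mul] at e2
    exact e2.congr fun n => by ring

variable [∀ l, IsProbabilityMeasure (ν l)]

theorem pgf_mem_Icc {s : Fin (M + 1) → ℝ} (h0 : ∀ j, 0 ≤ s j) (h1 : ∀ j, s j ≤ 1)
    (l : Fin (M + 1)) : pgf ν s l ∈ Set.Icc (0 : ℝ) 1 := by
  refine ⟨integral_nonneg fun k => (prod_pow_mem_Icc h0 h1 _ k).1, ?_⟩
  have := integral_mono (μ := ν l)
    (integrable_of_mem_Icc .of_discrete fun k => prod_pow_mem_Icc h0 h1 Finset.univ k)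
    (integrable_const (1 : ℝ)) fun k => (prod_pow_mem_Icc h0 h1 Finset.univ k).2
  simpa [pgf] using this

theorem pgf_mono {s s' : Fin (M + 1) → ℝ} (h0 : ∀ j, 0 ≤ s j) (hss : ∀ j, s j ≤ s' j)
    (h1 : ∀ j, s' j ≤ 1) (l : Fin (M + 1)) : pgf ν s l ≤ pgf ν s' l :=
  integral_mono
    (integrable_of_mem_Icc .of_discrete fun k =>
      prod_pow_mem_Icc h0 (fun j => (hss j).trans (h1 j)) Finset.univ k)
    (integrable_of_mem_Icc .of_discrete fun k =>
      prod_pow_mem_Icc (fun j => (h0 j).trans (hss j)) h1 Finset.univ k)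
    fun k => prod_pow_le_prod_pow h0 hss Finset.univ k

/-- `E[η_{i,i} (η_{i,i} - 1)] = 2 b_i`, as `E[η_{i,i}] = 1`. -/
theorem HypothesisA.integral_mul_sub_one (hA : HypothesisA ν) (i : Fin (M + 1)) :
    ∫ x, (x i : ℝ) * ((x i : ℝ) - 1) ∂(ν i) = 2 * halfVar ν i := by
  have h1 : MemLp (fun x : Fin (M + 1) → ℕ => (x i : ℝ)) 2 (ν i) := by
    rw [memLp_two_iff_integrable_sq (Measurable.of_discrete).aestronglyMeasurable]
    simpa [sq] using hA.secondMoments _ _ _ (le_refl i) (le_refl i)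
  have h2 := variance_eq_sub h1
  have h3 := hA.critical i
  unfold meanOffspring at h3
  rw [h3] at h2
  have h4 : ∫ x, (x i : ℝ) * ((x i : ℝ) - 1) ∂(ν i) =
      ∫ x, (x i : ℝ) * (x i : ℝ) ∂(ν i) - ∫ x, (x i : ℝ) ∂(ν i) := by
    rw [← integral_sub (hA.secondMoments _ _ _ le_rfl le_rfl) (hA.integrable_coord le_rfl)]
    congr 1; ext x; ring
  rw [h4, h3, halfVar, h2]
  simp only [Pi.pow_apply, sq]
  ring

/-- The exact two-step decomposition from which both the recursion for the survival probabilities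
(`s' = 1`) and that for their increments (`s`, `s'` consecutive) are read off. -/
theorem HypothesisA.pgf_sub_pgf (hA : HypothesisA ν) (i : Fin (M + 1)) {s s' : Fin (M + 1) → ℝ}
    (h0 : ∀ j, 0 ≤ s j) (hss : ∀ j, s j ≤ s' j) (h1 : ∀ j, s' j ≤ 1) :
    pgf ν s' i - pgf ν s i = diagSlope ν i s s' * (s' i - s i) + tailIncr ν i s s' := by
  have m1 : ∀ t t' : Fin (M + 1) → ℝ, (∀ j, 0 ≤ t j) → (∀ j, t j ≤ 1) → (∀ j, 0 ≤ t' j) →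
      (∀ j, t' j ≤ 1) → Integrable (fun k : Fin (M + 1) → ℕ =>
        t i ^ k i * ∏ j ∈ Finset.Ioi i, t' j ^ k j) (ν i) := by
    intro t t' a b c d
    refine integrable_of_mem_Icc .of_discrete fun k => ?_
    have h3 := prod_pow_mem_Icc c d (Finset.Ioi i) k
    exact ⟨mul_nonneg (pow_nonneg (a i) _) h3.1,
      mul_le_one₀ (pow_le_one₀ (a i) (b i)) h3.1 h3.2⟩
  have a1 := fun j => (hss j).trans (h1 j)
  have a2 := fun j => (h0 j).trans (hss j)
  rw [hA.pgf_eq, hA.pgf_eq, ← integral_sub (m1 _ _ a2 h1 a2 h1) (m1 _ _ h0 a1 h0 a1), diagSlope,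
    tailIncr, ← integral_mul_const, ← integral_add]
  · refine integral_congr_ae (.of_forall fun k => ?_)
    simp only
    have := (Commute.all (s' i) (s i)).geom_sum₂_mul (k i)
    linear_combination (-∏ j ∈ Finset.Ioi i, s' j ^ k j) * this
  · exact (hA.integrable_diagSlope i h0 hss h1).mul_const _
  · simp only [mul_sub]
    exact (m1 s s' h0 a1 a2 h1).sub (m1 s s h0 a1 h0 a1)

/-- Second-order behaviour in the critical coordinate: with `x = 1 - s i`, the mean slope is
`1 - (1 + r) * b_i * x + o(x)` if `1 - s' i ~ r * x` and the other coordinates deviate from `1` by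
`o(x)`. The value `r = 0` gives a secant through `1`, the value `r = 1` a tangent. This is where
the second moments `E[η_{i,i} η_{i,j}]` are needed, for the dominating function. -/
theorem HypothesisA.tendsto_one_sub_diagSlope (hA : HypothesisA ν) (i : Fin (M + 1))
    {s s' : ℕ → Fin (M + 1) → ℝ} {r : ℝ} (h0 : ∀ n j, 0 ≤ s n j)
    (hss : ∀ n j, s n j ≤ s' n j) (h1 : ∀ n j, s' n j ≤ 1) (hlt : ∀ n, s n i < 1)
    (hs : Tendsto (fun n => s n i) atTop (𝓝 1))
    (hr : Tendsto (fun n => (1 - s' n i) / (1 - s n i)) atTop (𝓝 r))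
    (h : ∀ j, i < j → Tendsto (fun n => (1 - s' n j) / (1 - s n i)) atTop (𝓝 0)) :
    Tendsto (fun n => (1 - diagSlope ν i (s n) (s' n)) / (1 - s n i)) atTop
      (𝓝 ((1 + r) * halfVar ν i)) := by
  have hpos : ∀ n, 0 < 1 - s n i := fun n => sub_pos.2 (hlt n)
  have hsi' : Tendsto (fun n => s' n i) atTop (𝓝 1) :=
    tendsto_of_tendsto_of_tendsto_of_le_of_le hs tendsto_const_nhds
      (fun n => hss n i) (fun n => h1 n i)
  have hsj' : ∀ j, i < j → Tendsto (fun n => s' n j) atTop (𝓝 1) := by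
    intro j hj
    have := ((h j hj).mul (hs.const_sub 1)).const_sub 1
    rw [zero_mul, sub_zero] at this
    exact this.congr fun n => by rw [div_mul_cancel₀ _ (hpos n).ne']; ring
  have hbd : ∀ᶠ n in atTop, ∀ j, i < j → (1 - s' n j) / (1 - s n i) ≤ 1 := by
    rw [eventually_all]; intro j
    by_cases hj : i < j
    · filter_upwards [(h j hj).eventually_le_const one_pos] with n hn _ using hn
    · exact .of_forall fun n h => absurd h hj
  -- The pointwise limit of the integrand in `hint` is the left-hand side of this sum.
  have hgauss : ∀ k : ℕ, ∑ a ∈ Finset.range k, ((a : ℝ) * r + (k - 1 - a : ℕ)) =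
      (1 + r) * (k * (k - 1) / 2) := by
    intro k
    rw [Finset.sum_add_distrib, ← Finset.sum_mul, ← Nat.cast_sum, ← Nat.cast_sum,
      Finset.sum_range_reflect (fun a => a) k]
    have h2 := Finset.sum_range_id_mul_two k
    have h3 : ((∑ a ∈ Finset.range k, a : ℕ) : ℝ) * 2 = k * (k - 1) := by
      rcases k with _ | k
      · simp
      · have := congrArg (Nat.cast (R := ℝ)) h2
        push_cast at this ⊢
        simpa using this
    linear_combination (1 + r) / 2 * h3
  have hlim : (1 + r) * halfVar ν i =
      ∫ k, ∑ a ∈ Finset.range (k i), ((a : ℝ) * r + (k i - 1 - a : ℕ)) ∂(ν i) := by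
    simp only [hgauss]
    rw [integral_const_mul, integral_div, hA.integral_mul_sub_one]
    ring
  have hint : ∀ n, (1 - diagSlope ν i (s n) (s' n)) / (1 - s n i) =
      ∫ k, (∑ a ∈ Finset.range (k i), (1 - s' n i ^ a * (s n i ^ (k i - 1 - a) *
        ∏ j ∈ Finset.Ioi i, s' n j ^ k j)) * (1 - s n i)⁻¹) ∂(ν i) := by
    intro n
    have h2 := hA.critical i
    unfold meanOffspring at h2
    rw [diagSlope, ← h2, ← integral_sub (hA.integrable_coord le_rfl)
      (hA.integrable_diagSlope i (h0 n) (hss n) (h1 n)), ← integral_div, h2]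
    refine integral_congr_ae (.of_forall fun k => ?_)
    simp only
    rw [← Finset.sum_mul, Finset.sum_sub_distrib, Finset.sum_mul, div_eq_mul_inv]
    simp [mul_assoc]
  simp only [hint]
  rw [hlim]
  have hbi : Integrable (fun k : Fin (M + 1) → ℕ => (k i : ℝ) * ((k i : ℝ) +
      ∑ j ∈ Finset.Ioi i, (k j : ℝ))) (ν i) := by
    simp only [mul_add, Finset.mul_sum]
    exact (hA.secondMoments _ _ _ le_rfl le_rfl).add (integrable_finsetSum _ fun j hj =>
      hA.secondMoments _ _ _ le_rfl (Finset.mem_Ioi.1 hj).le)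
  refine tendsto_integral_filter_of_dominated_convergence _
    (.of_forall fun n => (Measurable.of_discrete).aestronglyMeasurable) ?_ hbi
    (.of_forall fun k => tendsto_finsetSum _ fun a ha => ?_)
  · filter_upwards [hbd] with n hn
    refine .of_forall fun k => ?_
    have hprod := prod_pow_mem_Icc (fun j => (h0 n j).trans (hss n j)) (h1 n) (Finset.Ioi i) k
    have hprod2 : 1 - ∏ j ∈ Finset.Ioi i, s' n j ^ k j ≤
        ∑ j ∈ Finset.Ioi i, (k j : ℝ) * (1 - s' n j) := by
      simpa using prod_pow_sub_prod_pow_le (s' := fun _ => 1)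
        (fun j => (h0 n j).trans (hss n j)) (h1 n) (fun _ => le_rfl) (Finset.Ioi i) k
    have hprod3 : (1 - ∏ j ∈ Finset.Ioi i, s' n j ^ k j) * (1 - s n i)⁻¹ ≤
        ∑ j ∈ Finset.Ioi i, (k j : ℝ) := by
      refine (mul_le_mul_of_nonneg_right hprod2 (inv_nonneg.2 (hpos n).le)).trans ?_
      rw [Finset.sum_mul]
      refine Finset.sum_le_sum fun j hj => ?_
      rw [mul_assoc, ← div_eq_mul_inv]
      exact mul_le_of_le_one_right (by positivity) (hn j (Finset.mem_Ioi.1 hj))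
    have hsi1 : s n i ≤ 1 := (hlt n).le
    have hsi0 : 0 ≤ s' n i := (h0 n i).trans (hss n i)
    refine (norm_sum_le _ _).trans ?_
    calc _ ≤ ∑ a ∈ Finset.range (k i), ((k i : ℝ) + ∑ j ∈ Finset.Ioi i, (k j : ℝ)) := ?_
      _ = _ := by simp [mul_add]
    refine Finset.sum_le_sum fun a ha => ?_
    have hak : (a : ℝ) + (k i - 1 - a : ℕ) ≤ k i := by
      have := Finset.mem_range.1 ha
      exact_mod_cast (by omega : a + (k i - 1 - a) ≤ k i)
    set p := ∏ j ∈ Finset.Ioi i, s' n j ^ k j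
    set u := s' n i ^ a
    set v := s n i ^ (k i - 1 - a)
    have hu0 : 0 ≤ u := by positivity
    have hu1 : u ≤ 1 := pow_le_one₀ hsi0 (h1 n i)
    have hv0 : 0 ≤ v := pow_nonneg (h0 n i) _
    have hv1 : v ≤ 1 := pow_le_one₀ (h0 n i) hsi1
    have hvp0 : 0 ≤ v * p := mul_nonneg hv0 hprod.1
    have hvp1 : v * p ≤ 1 := mul_le_one₀ hv1 hprod.1 hprod.2
    have hu : 1 - u ≤ a * (1 - s n i) := by
      have e := pow_sub_pow_le_mul hsi0 (h1 n i) le_rfl a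
      rw [one_pow] at e
      refine e.trans (mul_le_mul_of_nonneg_left ?_ (by positivity))
      linarith [hss n i]
    have hv : 1 - v ≤ (k i - 1 - a : ℕ) * (1 - s n i) := by
      have e := pow_sub_pow_le_mul (h0 n i) hsi1 le_rfl (k i - 1 - a)
      rwa [one_pow] at e
    rw [Real.norm_of_nonneg (mul_nonneg (sub_nonneg.2 (mul_le_one₀ hu1 hvp0 hvp1))
      (inv_nonneg.2 (hpos n).le))]
    have hsplit : 1 - u * (v * p) ≤ (1 - u) + (1 - v) + (1 - p) := by
      have e1 := mul_le_of_le_one_left (sub_nonneg.2 hvp1) hu1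
      have e2 := mul_le_of_le_one_left (sub_nonneg.2 hprod.2) hv1
      linarith
    calc (1 - u * (v * p)) * (1 - s n i)⁻¹
        ≤ (((a : ℝ) + (k i - 1 - a : ℕ)) * (1 - s n i) + (1 - p)) * (1 - s n i)⁻¹ :=
          mul_le_mul_of_nonneg_right (by linarith) (inv_nonneg.2 (hpos n).le)
      _ = ((a : ℝ) + (k i - 1 - a : ℕ)) + (1 - p) * (1 - s n i)⁻¹ := by
          rw [add_mul, mul_assoc, mul_inv_cancel₀ (hpos n).ne', mul_one]
      _ ≤ _ := add_le_add hak hprod3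
  · have one : Tendsto (fun _ : ℕ => (1 : ℝ)) atTop (𝓝 1) := tendsto_const_nhds
    have e1 : Tendsto (fun n => (1 ^ a - s' n i ^ a) * (1 - s n i)⁻¹) atTop (𝓝 (a * r)) :=
      tendsto_pow_sub_pow hsi' one (by simpa [div_eq_mul_inv] using hr) a
    have e2 : Tendsto (fun n => (1 ^ (k i - 1 - a) - s n i ^ (k i - 1 - a)) * (1 - s n i)⁻¹) atTop
        (𝓝 ((k i - 1 - a : ℕ) * 1)) :=
      tendsto_pow_sub_pow hs one
        (one.congr fun n => (mul_inv_cancel₀ (hpos n).ne').symm) _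
    have e3 : Tendsto (fun n => (∏ j ∈ Finset.Ioi i, 1 ^ k j - ∏ j ∈ Finset.Ioi i, s' n j ^ k j) *
        (1 - s n i)⁻¹) atTop (𝓝 (∑ j ∈ Finset.Ioi i, (k j : ℝ) * 0)) :=
      tendsto_prod_pow_sub_prod_pow (s' := fun _ _ => 1) (ρ := fun _ => 0)
        (fun j hj => hsj' j (Finset.mem_Ioi.1 hj)) (fun _ _ => one)
        (fun j hj => by simpa [div_eq_mul_inv] using h j (Finset.mem_Ioi.1 hj)) k
    simp only [one_pow, Finset.prod_const_one, mul_one, mul_zero, Finset.sum_const_zero]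
      at e1 e2 e3
    have e4 := tendsto_mul_sub_mul (a' := fun _ => 1) (b' := fun _ => 1)
      (by simpa using hs.pow (k i - 1 - a)) one e2 e3
    have e5 := tendsto_mul_sub_mul (a' := fun _ => 1) (b' := fun _ => 1 * 1)
      (by simpa using hsi'.pow a) (by simp) e1 e4
    simpa using e5

end GeneratingFunctions

section Survival

/-! ### Asymptotics of the survival probabilities -/

variable {M : ℕ}

theorem gam_pos (i : Fin (M + 1)) : 0 < gam i := by unfold gam; positivity

theorem gam_last : gam (Fin.last M) = 1 := by simp [gam]

/-- `2 γ_i = γ_{i+1}`. -/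
theorem gam_castSucc (i : Fin M) : gam i.castSucc + gam i.castSucc = gam i.succ := by
  have h : M - (i : ℕ) = (M - ((i : ℕ) + 1)) + 1 := by omega
  simp only [gam, Fin.val_castSucc, Fin.val_succ]
  rw [h, pow_succ]
  field_simp
  norm_num

theorem gam_lt_gam {i j : Fin (M + 1)} (h : i < j) : gam i < gam j := by
  unfold gam
  have h1 : M - (j : ℕ) < M - (i : ℕ) := by omega
  exact one_div_lt_one_div_of_lt (by positivity) (pow_lt_pow_right₀ one_lt_two h1)

theorem rpow_one_div_two_pow_succ_sq {x : ℝ} (hx : 0 ≤ x) (a : ℕ) :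
    (x ^ ((1 : ℝ) / 2 ^ (a + 1))) ^ 2 = x ^ ((1 : ℝ) / 2 ^ a) := by
  rw [← Real.rpow_natCast, ← Real.rpow_mul hx]
  congr 1
  rw [pow_succ]
  push_cast
  field_simp

variable {ν : Fin (M + 1) → Measure (Fin (M + 1) → ℕ)}

theorem survivalConst_last : survivalConst ν (Fin.last M) = 1 / halfVar ν (Fin.last M) := by
  have : Finset.univ.filter (fun j : Fin M => Fin.last M ≤ j.castSucc) = ∅ := by
    ext j; simp
  rw [survivalConst, this]
  simp

theorem HypothesisA.survivalConst_pos (hA : HypothesisA ν) (i : Fin (M + 1)) :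
    0 < survivalConst ν i := by
  unfold survivalConst
  refine mul_pos (Real.rpow_pos_of_pos (one_div_pos.2 (hA.halfVar_pos _)) _)
    (Finset.prod_pos fun j _ => Real.rpow_pos_of_pos (div_pos (hA.next_pos j) (hA.halfVar_pos _)) _)

/-- The recursion `b_i c_{i,N} ^ 2 = m_{i,i+1} c_{i+1,N}` characterizing the constants. -/
theorem HypothesisA.halfVar_mul_survivalConst_sq (hA : HypothesisA ν) (i : Fin M) :
    halfVar ν i.castSucc * survivalConst ν i.castSucc ^ 2 =
      meanOffspring ν i.castSucc i.succ * survivalConst ν i.succ := by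
  have hset : Finset.univ.filter (fun j : Fin M => i.castSucc ≤ j.castSucc) =
      insert i (Finset.univ.filter fun j : Fin M => i.succ ≤ j.castSucc) := by
    ext j
    simp only [Finset.mem_filter, Finset.mem_univ, true_and, Finset.mem_insert,
      Fin.le_def, Fin.ext_iff, Fin.val_castSucc, Fin.val_succ]
    omega
  have hnot : i ∉ Finset.univ.filter fun j : Fin M => i.succ ≤ j.castSucc := by
    simp [Fin.le_def]
  have hexp : M - (i : ℕ) = (M - ((i : ℕ) + 1)) + 1 := by omega
  have hb := hA.halfVar_pos i.castSucc
  have hquot : ∀ j : Fin M, 0 ≤ meanOffspring ν j.castSucc j.succ / halfVar ν j.castSucc :=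
    fun j => (div_pos (hA.next_pos j) (hA.halfVar_pos _)).le
  have htail : ∏ j ∈ Finset.univ.filter (fun j : Fin M => i.succ ≤ j.castSucc),
      ((meanOffspring ν j.castSucc j.succ / halfVar ν j.castSucc) ^
        ((1 : ℝ) / 2 ^ ((j : ℕ) - (i : ℕ) + 1))) ^ 2 =
      ∏ j ∈ Finset.univ.filter (fun j : Fin M => i.succ ≤ j.castSucc),
      (meanOffspring ν j.castSucc j.succ / halfVar ν j.castSucc) ^
        ((1 : ℝ) / 2 ^ ((j : ℕ) - ((i : ℕ) + 1) + 1)) := by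
    refine Finset.prod_congr rfl fun j hj => ?_
    have hij : (i : ℕ) + 1 ≤ j := by
      simpa [Fin.le_def] using hj
    rw [rpow_one_div_two_pow_succ_sq (hquot j),
      show (j : ℕ) - (i : ℕ) = (j : ℕ) - ((i : ℕ) + 1) + 1 by omega]
  unfold survivalConst
  rw [hset, Finset.prod_insert hnot, mul_pow, mul_pow, ← Finset.prod_pow]
  simp only [Fin.val_castSucc, Fin.val_succ]
  rw [htail, hexp, rpow_one_div_two_pow_succ_sq (one_div_pos.2 (hA.halfVar_pos _)).le,
    rpow_one_div_two_pow_succ_sq (hquot i)]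
  simp only [Nat.sub_self, pow_zero, div_one, Real.rpow_one]
  field_simp

theorem tendsto_mul_rpow_of_lt {f : ℕ → ℝ} {a b L : ℝ} (hab : b < a)
    (h : Tendsto (fun n => f n * (n : ℝ) ^ a) atTop (𝓝 L)) :
    Tendsto (fun n => f n * (n : ℝ) ^ b) atTop (𝓝 0) := by
  have h1 : Tendsto (fun n : ℕ => (n : ℝ) ^ (-(a - b))) atTop (𝓝 0) :=
    (tendsto_rpow_neg_atTop (sub_pos.2 hab)).comp tendsto_natCast_atTop_atTop
  have h2 := h.mul h1
  rw [mul_zero] at h2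
  refine h2.congr' ((eventually_gt_atTop 0).mono fun n hn => ?_)
  have hn' : (0 : ℝ) < n := by exact_mod_cast hn
  rw [mul_assoc, ← Real.rpow_add hn']
  ring_nf

/-- `extinctProb ν n l` is the probability that a process started from one particle of type `l` is
extinct at time `n` (see `measureReal_generation_eq_zero`), defined as the `n`-th iterate of the
generating function at `0`. -/
def extinctProb (ν : Fin (M + 1) → Measure (Fin (M + 1) → ℕ)) (n : ℕ) : Fin (M + 1) → ℝ :=
  (pgf ν)^[n] 0

/-- The probability that a process started from one particle of type `i` survives time `n`. -/
def survProb (ν : Fin (M + 1) → Measure (Fin (M + 1) → ℕ)) (n : ℕ) (i : Fin (M + 1)) : ℝ :=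
  1 - extinctProb ν n i

theorem extinctProb_succ (n : ℕ) : extinctProb ν (n + 1) = pgf ν (extinctProb ν n) :=
  Function.iterate_succ_apply' _ _ _

/-- `HypothesisA.tendsto_tailIncr` when only type `i + 1` contributes on the scale `1 / w`. -/
theorem HypothesisA.tendsto_tailIncr_of_dominant (hA : HypothesisA ν) (i : Fin M)
    {s s' : ℕ → Fin (M + 1) → ℝ} {w : ℕ → ℝ} {ρ : ℝ} (h0 : ∀ n j, 0 ≤ s n j)
    (hss : ∀ n j, s n j ≤ s' n j) (h1 : ∀ n j, s' n j ≤ 1) (hw : ∀ n, 0 ≤ w n)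
    (hs : ∀ j, i.castSucc ≤ j → Tendsto (fun n => s n j) atTop (𝓝 1))
    (hnext : Tendsto (fun n => (s' n i.succ - s n i.succ) * w n) atTop (𝓝 ρ))
    (hrest : ∀ j, i.succ < j → Tendsto (fun n => (s' n j - s n j) * w n) atTop (𝓝 0)) :
    Tendsto (fun n => tailIncr ν i.castSucc (s n) (s' n) * w n) atTop
      (𝓝 (meanOffspring ν i.castSucc i.succ * ρ)) := by
  have := hA.tendsto_tailIncr i.castSucc (ρ := fun j => if j = i.succ then ρ else 0)
    h0 hss h1 hw hs fun j hj => ?_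
  · simpa [Finset.sum_ite_eq', Fin.castSucc_lt_succ] using this
  · by_cases hji : j = i.succ
    · subst hji; simpa using hnext
    · simpa [hji] using hrest j (lt_of_le_of_ne (Fin.castSucc_lt_iff_succ_le.1 hj) (Ne.symm hji))

/-- Both asymptotics carried through the induction over types: `Q_i(n) ~ c_{i,N} / n ^ γ_i` for the
survival probability `Q_i(n)`, and
`Q_i(n) - Q_i(n + 1) ~ γ_i c_{i,N} / n ^ (1 + γ_i)` for its increment. -/
def SurvivalAsymptotics (ν : Fin (M + 1) → Measure (Fin (M + 1) → ℕ)) (i : Fin (M + 1)) : Prop :=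
  Tendsto (fun n : ℕ => survProb ν n i * (n : ℝ) ^ gam i) atTop (𝓝 (survivalConst ν i)) ∧
  Tendsto (fun n : ℕ => (survProb ν n i - survProb ν (n + 1) i) * (n : ℝ) ^ (1 + gam i)) atTop
    (𝓝 (gam i * survivalConst ν i))

theorem SurvivalAsymptotics.tendsto_zero {j : Fin (M + 1)} (h : SurvivalAsymptotics ν j) :
    Tendsto (fun n => survProb ν n j) atTop (𝓝 0) := by
  simpa using tendsto_mul_rpow_of_lt (gam_pos j) h.1

/-- The coefficient `A` in `Q_i(n + 1) = Q_i(n) - A Q_i(n) ^ 2 + (contribution of types j > i)`. -/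
def quadCoeff (ν : Fin (M + 1) → Measure (Fin (M + 1) → ℕ)) (i : Fin (M + 1)) (n : ℕ) : ℝ :=
  (1 - diagSlope ν i (extinctProb ν n) fun _ => 1) / survProb ν n i

variable [∀ l, IsProbabilityMeasure (ν l)]

theorem extinctProb_mem_Icc (n : ℕ) : ∀ j, extinctProb ν n j ∈ Set.Icc (0 : ℝ) 1 := by
  induction n with
  | zero => intro j; simp [extinctProb]
  | succ n ih =>
    rw [extinctProb_succ]
    exact pgf_mem_Icc (fun j => (ih j).1) fun j => (ih j).2

theorem extinctProb_le_succ (n : ℕ) : ∀ j, extinctProb ν n j ≤ extinctProb ν (n + 1) j := by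
  induction n with
  | zero => intro j; exact (extinctProb_mem_Icc (ν := ν) 1 j).1
  | succ n ih =>
    intro j
    rw [extinctProb_succ, extinctProb_succ (n + 1)]
    exact pgf_mono (fun j => (extinctProb_mem_Icc n j).1) ih
      (fun j => (extinctProb_mem_Icc (n + 1) j).2) j

theorem HypothesisA.pgf_lt_one (hA : HypothesisA ν) {i : Fin (M + 1)} {s : Fin (M + 1) → ℝ}
    (h0 : ∀ j, 0 ≤ s j) (h1 : ∀ j, s j ≤ 1) (hi : s i < 1) : pgf ν s i < 1 := by
  refine lt_of_le_of_ne (pgf_mem_Icc h0 h1 i).2 fun h => ?_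
  have hint : Integrable (fun k : Fin (M + 1) → ℕ => ∏ j, s j ^ k j) (ν i) :=
    integrable_of_mem_Icc .of_discrete fun k => prod_pow_mem_Icc h0 h1 Finset.univ k
  have hzero : ∫ k, (1 - ∏ j, s j ^ k j) ∂(ν i) = 0 := by
    rw [integral_sub (integrable_const _) hint]
    simp only [pgf] at h
    simp [h]
  rw [integral_eq_zero_iff_of_nonneg
    (fun k => sub_nonneg.2 (prod_pow_mem_Icc h0 h1 Finset.univ k).2)
    ((integrable_const _).sub hint)] at hzero
  have hmean : ∫ k, (k i : ℝ) ∂(ν i) = 0 := by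
    refine integral_eq_zero_of_ae ?_
    filter_upwards [hzero, hA.prod_eq i s] with k hk hp
    simp only [Pi.zero_apply] at hk ⊢
    by_contra hne
    have hki : k i ≠ 0 := by exact_mod_cast hne
    have h2 := mul_le_of_le_one_right (pow_nonneg (h0 i) (k i))
      (prod_pow_mem_Icc h0 h1 (Finset.Ioi i) k).2
    have h3 := pow_lt_one₀ (h0 i) hi hki
    linarith
  have := hA.critical i
  unfold meanOffspring at this
  linarith

theorem HypothesisA.survProb_pos (hA : HypothesisA ν) (n : ℕ) (i : Fin (M + 1)) :
    0 < survProb ν n i := by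
  rw [survProb, sub_pos]
  induction n with
  | zero => simp [extinctProb]
  | succ n ih =>
    rw [extinctProb_succ]
    exact hA.pgf_lt_one (fun j => (extinctProb_mem_Icc n j).1)
      (fun j => (extinctProb_mem_Icc n j).2) ih

theorem one_add_mul_sub_lt_pow {x : ℝ} (hx0 : 0 ≤ x) (hx1 : x < 1) {k : ℕ} (hk : 2 ≤ k) :
    1 + k * (x - 1) < x ^ k := by
  obtain ⟨m, rfl⟩ := Nat.exists_eq_add_of_le' hk
  have h1 := one_add_mul_sub_le_pow (by linarith : -1 ≤ x) (m + 1)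
  have h2 := mul_le_mul_of_nonneg_left h1 hx0
  rw [← pow_succ'] at h2
  have h3 : 0 < ((m : ℝ) + 1) * (x - 1) ^ 2 := by
    have : x - 1 ≠ 0 := by linarith
    positivity
  push_cast at h2 ⊢
  linarith

/-- The generating function of `η_{i,i}` has `1` as its only fixed point in `[0, 1]`: it lies above
its tangent `x` at `1` by Bernoulli's inequality, strictly so as `η_{i,i} ≥ 2` with positive
probability. -/
theorem HypothesisA.eq_one_of_integral_pow_eq (hA : HypothesisA ν) (i : Fin (M + 1)) {x : ℝ}
    (hx0 : 0 ≤ x) (hx1 : x ≤ 1) (h : ∫ k, x ^ k i ∂(ν i) = x) : x = 1 := by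
  by_contra hne
  have hlt : x < 1 := lt_of_le_of_ne hx1 hne
  have hint : Integrable (fun k : Fin (M + 1) → ℕ => x ^ k i) (ν i) :=
    integrable_of_mem_Icc .of_discrete fun k => ⟨pow_nonneg hx0 _, pow_le_one₀ hx0 hx1⟩
  have hint2 : Integrable (fun k : Fin (M + 1) → ℕ => 1 + (k i : ℝ) * (x - 1)) (ν i) :=
    (integrable_const _).add ((hA.integrable_coord le_rfl).mul_const _)
  have hm := hA.critical i
  unfold meanOffspring at hm
  have hzero : ∫ k, (x ^ k i - (1 + (k i : ℝ) * (x - 1))) ∂(ν i) = 0 := by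
    rw [integral_sub hint hint2, integral_add (integrable_const _)
      ((hA.integrable_coord le_rfl).mul_const _), integral_mul_const, hm, h]
    simp
  rw [integral_eq_zero_iff_of_nonneg
    (fun k => sub_nonneg.2 (one_add_mul_sub_le_pow (by linarith) _)) (hint.sub hint2)] at hzero
  have hvar : ∫ k, (k i : ℝ) * ((k i : ℝ) - 1) ∂(ν i) = 0 := by
    refine integral_eq_zero_of_ae ?_
    filter_upwards [hzero] with k hk
    have h2 : k i < 2 := by
      by_contra hc
      have := one_add_mul_sub_lt_pow hx0 hlt (not_lt.1 hc)
      simp only [Pi.zero_apply] at hk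
      linarith
    interval_cases k i <;> simp
  rw [hA.integral_mul_sub_one] at hvar
  linarith [hA.halfVar_pos i]

/-- Extinction is almost sure. If the later types die out, the limit of the extinction
probabilities of type `i` is a fixed point of the generating function of `η_{i,i}`. -/
theorem HypothesisA.tendsto_survProb_zero (hA : HypothesisA ν) (i : Fin (M + 1))
    (h : ∀ j, i < j → Tendsto (fun n => survProb ν n j) atTop (𝓝 0)) :
    Tendsto (fun n => survProb ν n i) atTop (𝓝 0) := by
  have hmono : Monotone fun n => extinctProb ν n i :=
    monotone_nat_of_le_succ fun n => extinctProb_le_succ n i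
  have hlim := tendsto_atTop_ciSup hmono
    ⟨1, by rintro _ ⟨n, rfl⟩; exact (extinctProb_mem_Icc n i).2⟩
  set x := ⨆ n, extinctProb ν n i
  have hx0 : 0 ≤ x := ge_of_tendsto' hlim fun n => (extinctProb_mem_Icc n i).1
  have hx1 : x ≤ 1 := le_of_tendsto' hlim fun n => (extinctProb_mem_Icc n i).2
  have hj : ∀ j, i < j → Tendsto (fun n => extinctProb ν n j) atTop (𝓝 1) := by
    intro j hj
    simpa [survProb] using (h j hj).const_sub 1
  have hstep : Tendsto (fun n => extinctProb ν (n + 1) i) atTop (𝓝 (∫ k, x ^ k i ∂(ν i))) := by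
    simp only [extinctProb_succ, hA.pgf_eq]
    refine tendsto_integral_filter_of_dominated_convergence (fun _ => 1)
      (.of_forall fun n => (Measurable.of_discrete).aestronglyMeasurable)
      (.of_forall fun n => .of_forall fun k => ?_) (integrable_const _) (.of_forall fun k => ?_)
    · have h2 := prod_pow_mem_Icc (fun j => (extinctProb_mem_Icc (ν := ν) n j).1)
        (fun j => (extinctProb_mem_Icc n j).2) (Finset.Ioi i) k
      have h3 := extinctProb_mem_Icc (ν := ν) n i
      rw [Real.norm_of_nonneg (mul_nonneg (pow_nonneg h3.1 _) h2.1)]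
      exact mul_le_one₀ (pow_le_one₀ h3.1 h3.2) h2.1 h2.2
    · have h2 := tendsto_finsetProd (Finset.Ioi i)
        fun j hj' => (hj j (Finset.mem_Ioi.1 hj')).pow (k j)
      simpa using (hlim.pow (k i)).mul h2
  have hx := hA.eq_one_of_integral_pow_eq i hx0 hx1
    (tendsto_nhds_unique hstep ((tendsto_add_atTop_iff_nat 1).2 hlim))
  rw [hx] at hlim
  simpa [survProb] using hlim.const_sub 1

theorem pgf_one (i : Fin (M + 1)) : pgf ν (fun _ => 1) i = 1 := by simp [pgf]

theorem HypothesisA.survProb_succ (hA : HypothesisA ν) (i : Fin (M + 1)) (n : ℕ) :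
    survProb ν (n + 1) i = survProb ν n i - quadCoeff ν i n * survProb ν n i ^ 2 +
      tailIncr ν i (extinctProb ν n) fun _ => 1 := by
  have h := hA.pgf_sub_pgf i (fun j => (extinctProb_mem_Icc (ν := ν) n j).1)
    (fun j => (extinctProb_mem_Icc n j).2) (fun _ => le_rfl)
  rw [pgf_one, ← extinctProb_succ] at h
  rw [quadCoeff, sq, ← mul_assoc, div_mul_cancel₀ _ (hA.survProb_pos n i).ne', survProb, h,
    survProb]
  ring

theorem HypothesisA.tendsto_quadCoeff (hA : HypothesisA ν) (i : Fin (M + 1))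
    (h : Tendsto (fun n => survProb ν n i) atTop (𝓝 0)) :
    Tendsto (quadCoeff ν i) atTop (𝓝 (halfVar ν i)) := by
  have := hA.tendsto_one_sub_diagSlope i (s := extinctProb ν) (s' := fun _ _ => 1) (r := 0)
    (fun n j => (extinctProb_mem_Icc n j).1) (fun n j => (extinctProb_mem_Icc n j).2)
    (fun _ _ => le_rfl) (fun n => sub_pos.1 (hA.survProb_pos n i))
    (by simpa [survProb] using h.const_sub 1) (by simp) (by simp)
  rwa [add_zero, one_mul] at this

theorem HypothesisA.survivalAsymptotics_last (hA : HypothesisA ν) :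
    SurvivalAsymptotics ν (Fin.last M) := by
  have hq0 := hA.tendsto_survProb_zero (Fin.last M) fun j hj => absurd hj (not_lt.2 (Fin.le_last j))
  have hrec : ∀ n, survProb ν (n + 1) (Fin.last M) = survProb ν n (Fin.last M) -
      quadCoeff ν (Fin.last M) n * survProb ν n (Fin.last M) ^ 2 := by
    intro n
    have : Finset.Ioi (Fin.last M) = ∅ := by ext j; simp [Fin.le_last]
    rw [hA.survProb_succ, tailIncr, this]
    simp
  have hAlim := hA.tendsto_quadCoeff _ hq0
  have hlim := tendsto_natCast_mul_of_quadratic_rec (hA.halfVar_pos _)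
    (fun n => hA.survProb_pos n _) hq0 hrec hAlim
  unfold SurvivalAsymptotics
  rw [gam_last, survivalConst_last]
  refine ⟨by simpa using hlim, ?_⟩
  have h2 := hAlim.mul (hlim.pow 2)
  have hb := (hA.halfVar_pos (Fin.last M)).ne'
  have e : halfVar ν (Fin.last M) * (1 / halfVar ν (Fin.last M)) ^ 2 =
      1 * (1 / halfVar ν (Fin.last M)) := by field_simp
  rw [e] at h2
  refine h2.congr fun n => ?_
  rw [hrec, one_add_one_eq_two, Real.rpow_two]
  ring

/-- The induction step. The survival probability of type `i` is driven by that of type `i + 1`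
through a quadratic recursion; its increment satisfies a linear recursion with contraction rate
`2 b_i Q_i(n) ~ 2 b_i c_{i,N} / n ^ γ_i`, driven by the increment of type `i + 1`. Types beyond
`i + 1` decay with larger exponents and do not contribute. -/
theorem HypothesisA.survivalAsymptotics_castSucc (hA : HypothesisA ν) (i : Fin M)
    (ih : ∀ j, i.castSucc < j → SurvivalAsymptotics ν j) :
    SurvivalAsymptotics ν i.castSucc := by
  have hlt : i.castSucc < i.succ := Fin.castSucc_lt_succ
  have hγ0 := gam_pos i.castSucc
  have hγ2 := gam_castSucc i
  have hγ1 : gam i.castSucc < 1 := by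
    rw [← gam_last (M := M)]; exact gam_lt_gam (Fin.castSucc_lt_last i)
  have hb := hA.halfVar_pos i.castSucc
  have hc := hA.survivalConst_pos i.castSucc
  have hcc := hA.halfVar_mul_survivalConst_sq i
  have hq0 := hA.tendsto_survProb_zero i.castSucc fun j hj => (ih j hj).tendsto_zero
  have hE : ∀ j, i.castSucc ≤ j → Tendsto (fun n => extinctProb ν n j) atTop (𝓝 1) := by
    intro j hj
    have : Tendsto (fun n => survProb ν n j) atTop (𝓝 0) := by
      rcases hj.eq_or_lt with rfl | hj
      · exact hq0
      · exact (ih j hj).tendsto_zero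
    simpa [survProb] using this.const_sub 1
  have hq : Tendsto (fun n : ℕ => survProb ν n i.castSucc * (n : ℝ) ^ gam i.castSucc) atTop
      (𝓝 (survivalConst ν i.castSucc)) := by
    refine tendsto_mul_rpow_of_quadratic_rec hγ0 hγ1 hb hc (fun n => (hA.survProb_pos n _).le)
      (hA.survProb_succ _) (hA.tendsto_quadCoeff _ hq0) ?_
    rw [hcc, hγ2]
    exact hA.tendsto_tailIncr_of_dominant i (s := extinctProb ν) (s' := fun _ _ => 1)
      (fun n j => (extinctProb_mem_Icc n j).1) (fun n j => (extinctProb_mem_Icc n j).2)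
      (fun _ _ => le_rfl) (fun n => by positivity) hE (ih _ hlt).1
      (fun j hj => tendsto_mul_rpow_of_lt (gam_lt_gam hj) (ih j (hlt.trans hj)).1)
  refine ⟨hq, ?_⟩
  have hratio : Tendsto (fun n => survProb ν (n + 1) i.castSucc / survProb ν n i.castSucc) atTop
      (𝓝 1) := by
    have h1 := (((tendsto_add_atTop_iff_nat 1).2 hq).div hq hc.ne').div
      (tendsto_succ_div_rpow (gam i.castSucc)) one_ne_zero
    rw [div_self hc.ne', div_one] at h1
    refine h1.congr' ((eventually_gt_atTop 0).mono fun n hn => ?_)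
    have hn' : (0 : ℝ) < n := by exact_mod_cast hn
    have h2 : (0 : ℝ) < ((n + 1 : ℕ) : ℝ) := by positivity
    have h3 := Real.rpow_pos_of_pos hn' (gam i.castSucc)
    have h4 := Real.rpow_pos_of_pos h2 (gam i.castSucc)
    have h5 := hA.survProb_pos n i.castSucc
    simp only [Pi.div_apply]
    rw [Real.div_rpow h2.le hn'.le]
    field_simp
  -- The secant between consecutive generations is asymptotically a tangent: `r = 1` by `hratio`.
  have hslope := hA.tendsto_one_sub_diagSlope i.castSucc (s := extinctProb ν)
    (s' := fun n => extinctProb ν (n + 1)) (r := 1)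
    (fun n j => (extinctProb_mem_Icc n j).1) extinctProb_le_succ
    (fun n j => (extinctProb_mem_Icc (n + 1) j).2) (fun n => sub_pos.1 (hA.survProb_pos n _))
    (hE _ le_rfl) hratio fun j hj => ?_
  swap
  · have h0 := tendsto_mul_rpow_of_lt (gam_lt_gam hj) (ih j hj).1
    have h1 : Tendsto (fun n => survProb ν n j / survProb ν n i.castSucc) atTop (𝓝 0) := by
      have := h0.div hq hc.ne'
      rw [zero_div] at this
      refine this.congr' ((eventually_gt_atTop 0).mono fun n hn => ?_)
      have hn' : (0 : ℝ) < n := by exact_mod_cast hn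
      exact mul_div_mul_right _ _ (Real.rpow_pos_of_pos hn' _).ne'
    refine squeeze_zero (fun n => ?_) (fun n => ?_) h1
    · exact div_nonneg (hA.survProb_pos (n + 1) j).le (hA.survProb_pos n _).le
    · exact div_le_div_of_nonneg_right (sub_le_sub_left (extinctProb_le_succ n j) 1)
        (hA.survProb_pos n _).le
  have hd : ∀ n j, survProb ν n j - survProb ν (n + 1) j =
      extinctProb ν (n + 1) j - extinctProb ν n j := fun n j => by simp only [survProb]; ring
  have key := tendsto_mul_rpow_of_rec (ρ := 1 + gam i.castSucc)
    (d := fun n => survProb ν n i.castSucc - survProb ν (n + 1) i.castSucc)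
    (e := fun n => 1 - diagSlope ν i.castSucc (extinctProb ν n) (extinctProb ν (n + 1)))
    (s := fun n => tailIncr ν i.castSucc (extinctProb ν n) (extinctProb ν (n + 1)))
    (α := (1 + 1) * halfVar ν i.castSucc * survivalConst ν i.castSucc)
    (σ := meanOffspring ν i.castSucc i.succ * (gam i.succ * survivalConst ν i.succ))
    hγ0 hγ1 (by positivity) (fun n => ?_) ?_ ?_
  · convert key using 2
    rw [← hγ2, eq_div_iff (by positivity)]
    linear_combination (2 * gam i.castSucc) * hcc
  · simp only [hd]
    have h := hA.pgf_sub_pgf i.castSucc (fun j => (extinctProb_mem_Icc (ν := ν) n j).1)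
      (extinctProb_le_succ n) (fun j => (extinctProb_mem_Icc (n + 1) j).2)
    rw [← extinctProb_succ, ← extinctProb_succ] at h
    rw [h]
    ring
  · refine (hslope.mul hq).congr fun n => ?_
    have h5 := hA.survProb_pos n i.castSucc
    rw [← mul_assoc]
    congr 1
    exact div_mul_cancel₀ _ h5.ne'
  · rw [add_assoc, hγ2]
    refine hA.tendsto_tailIncr_of_dominant i (s := extinctProb ν)
      (s' := fun n => extinctProb ν (n + 1))
      (fun n j => (extinctProb_mem_Icc n j).1) extinctProb_le_succ
      (fun n j => (extinctProb_mem_Icc (n + 1) j).2) (fun n => by positivity) hE ?_ ?_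
    · simpa only [hd] using (ih _ hlt).2
    · intro j hj
      have := tendsto_mul_rpow_of_lt (add_lt_add_right (gam_lt_gam hj) 1) (ih j (hlt.trans hj)).2
      simpa only [hd] using this

theorem HypothesisA.survivalAsymptotics (hA : HypothesisA ν) (i : Fin (M + 1)) :
    SurvivalAsymptotics ν i := by
  induction i using WellFoundedGT.induction with
  | ind i ih =>
    induction i using Fin.lastCases with
    | last => exact hA.survivalAsymptotics_last
    | cast i => exact hA.survivalAsymptotics_castSucc i ih

end Survival

section Branching

/-! ### The branching process and its extinction moment -/

theorem measurable_sum_range_of_measurable {Ω E : Type*} [MeasurableSpace Ω] [MeasurableSpace E]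
    [AddCommMonoid E] [MeasurableAdd₂ E] {N : Ω → ℕ} {f : ℕ → Ω → E} (hN : Measurable N)
    (hf : ∀ k, Measurable (f k)) : Measurable fun ω => ∑ k ∈ Finset.range (N ω), f k ω := by
  have h : Measurable fun p : Ω × ℕ => ∑ k ∈ Finset.range p.2, f k p.1 :=
    measurable_from_prod_countable_left fun n =>
      Finset.measurable_sum (Finset.range n) fun k _ => hf k
  exact h.comp (measurable_id.prodMk hN)

theorem integral_eq_of_setIntegral_fiber_eq {Ω α : Type*} [MeasurableSpace Ω] [MeasurableSpace α]
    [MeasurableSingletonClass α] [Countable α] {P : Measure Ω} {Y : Ω → α} (hY : Measurable Y)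
    {f g : Ω → ℝ} (hf : Integrable f P) (hg : Integrable g P)
    (h : ∀ z, ∫ ω in Y ⁻¹' {z}, f ω ∂P = ∫ ω in Y ⁻¹' {z}, g ω ∂P) :
    ∫ ω, f ω ∂P = ∫ ω, g ω ∂P := by
  have hU : ⋃ z, Y ⁻¹' {z} = Set.univ := by
    ext ω; simp
  have hd : Pairwise (Function.onFun Disjoint fun z => Y ⁻¹' {z}) := fun a b hab =>
    Disjoint.preimage _ (Set.disjoint_singleton.2 hab)
  have hm : ∀ z, MeasurableSet (Y ⁻¹' {z}) := fun z => hY (measurableSet_singleton z)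
  have h1 := hasSum_integral_iUnion hm hd hf.integrableOn
  have h2 := hasSum_integral_iUnion hm hd hg.integrableOn
  simp only [hU, Measure.restrict_univ] at h1 h2
  simp only [h] at h1
  exact h1.unique h2

variable {M : ℕ} {Ω : Type*} {Z : ℕ → Ω → Fin (M + 1) → ℕ}
  {ξ : ℕ → Fin (M + 1) → ℕ → Ω → Fin (M + 1) → ℕ} {i : Fin (M + 1)}

/-- Generation `n` depends only on the offspring vectors of the generations before it. The
measurable space is arbitrary, so that this applies to the sigma-algebra of the past as well. -/
theorem measurable_generation [MeasurableSpace Ω] (h0 : ∀ ω, Z 0 ω = Pi.single i 1)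
    (hstep : ∀ n ω, Z (n + 1) ω = ∑ l, ∑ k ∈ Finset.range (Z n ω l), ξ n l k ω) {n : ℕ}
    (hξ : ∀ m < n, ∀ l k, Measurable (ξ m l k)) : Measurable (Z n) := by
  induction n with
  | zero =>
    rw [funext h0]
    exact measurable_const
  | succ n ih =>
    rw [funext (hstep n)]
    refine Finset.measurable_sum _ fun l _ => measurable_sum_range_of_measurable ?_
      fun k => hξ n (Nat.lt_succ_self n) l k
    exact (measurable_pi_apply l).comp (ih fun m hm => hξ m (hm.trans (Nat.lt_succ_self n)))

/-- The sigma-algebra generated by the offspring vectors `ξ n l k` with `(n, l, k) ∈ T`. It is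
reducible because it is passed as an explicit `MeasurableSpace` structure. -/
@[reducible] def offspringAlgebra (ξ : ℕ → Fin (M + 1) → ℕ → Ω → Fin (M + 1) → ℕ)
    (T : Set (ℕ × Fin (M + 1) × ℕ)) : MeasurableSpace Ω :=
  ⨆ a ∈ T, MeasurableSpace.comap (ξ a.1 a.2.1 a.2.2) inferInstance

theorem measurable_offspringAlgebra {T : Set (ℕ × Fin (M + 1) × ℕ)} {n : ℕ} {l : Fin (M + 1)}
    {k : ℕ} (h : (n, l, k) ∈ T) : Measurable[offspringAlgebra ξ T] (ξ n l k) :=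
  measurable_iff_comap_le.2 (le_iSup₂_of_le (f := fun (a : ℕ × Fin (M + 1) × ℕ) (_ : a ∈ T) =>
    MeasurableSpace.comap (ξ a.1 a.2.1 a.2.2) inferInstance) (n, l, k) h le_rfl)

theorem measurableSet_generation_offspringAlgebra (h0 : ∀ ω, Z 0 ω = Pi.single i 1)
    (hstep : ∀ n ω, Z (n + 1) ω = ∑ l, ∑ k ∈ Finset.range (Z n ω l), ξ n l k ω) (n : ℕ)
    (z : Fin (M + 1) → ℕ) :
    MeasurableSet[offspringAlgebra ξ {a | a.1 < n}] (Z n ⁻¹' {z}) :=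
  @measurable_generation M Ω Z ξ i (offspringAlgebra ξ {a | a.1 < n}) h0 hstep n
    (fun _ hm _ _ => measurable_offspringAlgebra hm) _ (measurableSet_singleton z)

theorem prod_pow_sum_eq (s : Fin (M + 1) → ℝ) (z : Fin (M + 1) → ℕ)
    (x : Fin (M + 1) → ℕ → Fin (M + 1) → ℕ) :
    ∏ j, s j ^ (∑ l, ∑ k ∈ Finset.range (z l), x l k) j =
      ∏ a : Σ l, Fin (z l), ∏ j, s j ^ x a.1 a.2 j := by
  rw [Fintype.prod_sigma]
  simp only [Finset.sum_apply, ← Finset.prod_pow_eq_pow_sum]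
  rw [Finset.prod_comm]
  refine Finset.prod_congr rfl fun l _ => ?_
  rw [Finset.prod_comm, Finset.prod_range]

/-- Extinction at time `m + 1` means being alive at time `m` and dead at time `m + 1`. The types
`j < i` never occur, so dead means `Z = 0`; and the state `0` is absorbing. The assumption `1 ≤ m`
reflects that the extinction moment ignores time `0`. -/
theorem extinctionMoment_eq_succ_iff
    (hstep : ∀ n ω, Z (n + 1) ω = ∑ l, ∑ k ∈ Finset.range (Z n ω l), ξ n l k ω) {ω : Ω}
    (hω : ∀ n j, j < i → Z n ω j = 0) {m : ℕ} (hm : 1 ≤ m) :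
    extinctionMoment Z i (Fin.last M) ω = ((m + 1 : ℕ) : ℕ∞) ↔ Z (m + 1) ω = 0 ∧ Z m ω ≠ 0 := by
  have hsum : ∀ n, ∑ l ∈ Finset.Icc i (Fin.last M), Z n ω l = 0 ↔ Z n ω = 0 := by
    intro n
    rw [Finset.sum_eq_zero_iff]
    constructor
    · intro h
      funext j
      rcases lt_or_ge j i with hj | hj
      · exact hω n j hj
      · exact h j (Finset.mem_Icc.2 ⟨hj, Fin.le_last j⟩)
    · intro h j _
      simp [h]
  have hmono : ∀ n k, Z n ω = 0 → Z (n + k) ω = 0 := by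
    intro n k h
    induction k with
    | zero => exact h
    | succ k ih => rw [← add_assoc, hstep]; simp [ih]
  simp only [extinctionMoment, hsum]
  constructor
  · intro h
    have hle : ∀ n, 1 ≤ n → Z n ω = 0 → m + 1 ≤ n := by
      intro n h1 h2
      have : ((m + 1 : ℕ) : ℕ∞) ≤ n := by rw [← h]; exact iInf₂_le n ⟨h1, h2⟩
      exact_mod_cast this
    refine ⟨?_, fun h2 => absurd (hle m hm h2) (by omega)⟩
    by_contra hne
    have : ((m + 2 : ℕ) : ℕ∞) ≤ ((m + 1 : ℕ) : ℕ∞) := by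
      rw [← h]
      refine le_iInf₂ fun n hn => ?_
      have h1 := hle n hn.1 hn.2
      have h2 : n ≠ m + 1 := fun e => hne (e ▸ hn.2)
      exact_mod_cast (by omega : m + 2 ≤ n)
    have : m + 2 ≤ m + 1 := by exact_mod_cast this
    omega
  · rintro ⟨h1, h2⟩
    refine le_antisymm (iInf₂_le (m + 1) ⟨by omega, h1⟩) (le_iInf₂ fun n hn => ?_)
    have : m + 1 ≤ n := by
      by_contra hlt
      obtain ⟨k, rfl⟩ := Nat.exists_eq_add_of_le (by omega : n ≤ m)
      exact h2 (hmono n k hn.2)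
    exact_mod_cast this

variable [mΩ : MeasurableSpace Ω] {P : Measure Ω}
  {ν : Fin (M + 1) → Measure (Fin (M + 1) → ℕ)}

theorem indep_past_present (hmeas : ∀ n l k, Measurable (ξ n l k))
    (hind : iIndepFun (fun a : ℕ × Fin (M + 1) × ℕ => ξ a.1 a.2.1 a.2.2) P) (n : ℕ) :
    Indep (offspringAlgebra ξ {a | a.1 < n})
      (MeasurableSpace.comap (fun ω (b : Fin (M + 1) × ℕ) => ξ n b.1 b.2 ω) inferInstance) P := by
  have h := indep_iSup_of_disjoint
    (fun a : ℕ × Fin (M + 1) × ℕ => (hmeas a.1 a.2.1 a.2.2).comap_le) hind.iIndep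
    (S := {a | a.1 < n}) (T := {a | a.1 = n})
    (Set.disjoint_left.2 fun a (h1 : a.1 < n) (h2 : a.1 = n) => h1.ne h2)
  refine indep_of_indep_of_le_right (m₂ := offspringAlgebra ξ {a | a.1 = n}) h
    (measurable_iff_comap_le.1 ?_)
  exact @measurable_pi_lambda _ _ _ (offspringAlgebra ξ {a | a.1 = n}) _ _
    fun b => measurable_offspringAlgebra (n := n) (l := b.1) (k := b.2) rfl

theorem integral_prod_offspring (hmeas : ∀ n l k, Measurable (ξ n l k))
    (hlaw : ∀ n l k, P.map (ξ n l k) = ν l)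
    (hind : iIndepFun (fun a : ℕ × Fin (M + 1) × ℕ => ξ a.1 a.2.1 a.2.2) P) (n : ℕ)
    (s : Fin (M + 1) → ℝ) (z : Fin (M + 1) → ℕ) :
    ∫ ω, ∏ a : Σ l, Fin (z l), ∏ j, s j ^ ξ n a.1 a.2 ω j ∂P = ∏ l, pgf ν s l ^ z l := by
  have hinj : Function.Injective
      fun a : Σ l, Fin (z l) => ((n, a.1, (a.2 : ℕ)) : ℕ × Fin (M + 1) × ℕ) := by
    rintro ⟨l, k⟩ ⟨l', k'⟩ h
    simp only [Prod.mk.injEq, true_and] at h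
    obtain ⟨rfl, h⟩ := h
    rw [Fin.ext h]
  have h := (hind.precomp hinj).integral_fun_prod_comp
    (f := fun (_ : Σ l, Fin (z l)) (x : Fin (M + 1) → ℕ) => ∏ j, s j ^ x j)
    (fun a => (hmeas n a.1 a.2).aemeasurable)
    (fun a => (Measurable.of_discrete).aestronglyMeasurable)
  refine h.trans ?_
  rw [Fintype.prod_sigma]
  refine Finset.prod_congr rfl fun l _ => ?_
  have : ∀ k : Fin (z l), ∫ ω, ∏ j, s j ^ ξ n l k ω j ∂P = pgf ν s l := by
    intro k
    rw [pgf, ← hlaw n l k, integral_map (hmeas n l k).aemeasurable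
      (Measurable.of_discrete).aestronglyMeasurable]
  simp [this]

theorem HypothesisA.ae_generation_eq_zero (hA : HypothesisA ν)
    (hmeas : ∀ n l k, Measurable (ξ n l k)) (hlaw : ∀ n l k, P.map (ξ n l k) = ν l)
    (h0 : ∀ ω, Z 0 ω = Pi.single i 1)
    (hstep : ∀ n ω, Z (n + 1) ω = ∑ l, ∑ k ∈ Finset.range (Z n ω l), ξ n l k ω) :
    ∀ᵐ ω ∂P, ∀ n j, j < i → Z n ω j = 0 := by
  have h : ∀ᵐ ω ∂P, ∀ n l k j, j < l → ξ n l k ω j = 0 := by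
    simp only [ae_all_iff]
    intro n l k j hj
    have := hA.decomposable l j hj
    rw [← hlaw n l k] at this
    exact ae_of_ae_map (hmeas n l k).aemeasurable this
  filter_upwards [h] with ω hω n
  induction n with
  | zero => intro j hj; simp [h0, hj.ne]
  | succ n ih =>
    intro j hj
    rw [hstep, Finset.sum_apply]
    refine Finset.sum_eq_zero fun l _ => ?_
    rcases lt_or_ge l i with hl | hl
    · simp [ih l hl]
    · rw [Finset.sum_apply]
      exact Finset.sum_eq_zero fun k _ => hω n l k j (hj.trans_le hl)

variable [IsProbabilityMeasure P] [∀ l, IsProbabilityMeasure (ν l)]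

/-- The branching property: given generation `n`, its particles reproduce independently, so that the
conditional expectation of `s ^ Z (n + 1)` is `(pgf ν s) ^ Z n`. The conditioning is done on each
of the countably many events `Z n = z`. -/
theorem integral_prod_pow_succ (hmeas : ∀ n l k, Measurable (ξ n l k))
    (hlaw : ∀ n l k, P.map (ξ n l k) = ν l)
    (hind : iIndepFun (fun a : ℕ × Fin (M + 1) × ℕ => ξ a.1 a.2.1 a.2.2) P)
    (h0 : ∀ ω, Z 0 ω = Pi.single i 1)
    (hstep : ∀ n ω, Z (n + 1) ω = ∑ l, ∑ k ∈ Finset.range (Z n ω l), ξ n l k ω) (n : ℕ)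
    {s : Fin (M + 1) → ℝ} (hs0 : ∀ j, 0 ≤ s j) (hs1 : ∀ j, s j ≤ 1) :
    ∫ ω, ∏ j, s j ^ Z (n + 1) ω j ∂P = ∫ ω, ∏ l, pgf ν s l ^ Z n ω l ∂P := by
  have hZ : ∀ n, Measurable (Z n) := fun n => measurable_generation h0 hstep fun m _ => hmeas m
  have hint : ∀ n (t : Fin (M + 1) → ℝ), (∀ j, 0 ≤ t j) → (∀ j, t j ≤ 1) →
      Integrable (fun ω => ∏ j, t j ^ Z n ω j) P := fun n t ht0 ht1 =>
    integrable_of_mem_Icc (Measurable.of_discrete.comp (hZ n)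
      (g := fun k : Fin (M + 1) → ℕ => ∏ j, t j ^ k j))
      fun ω => prod_pow_mem_Icc ht0 ht1 Finset.univ (Z n ω)
  refine integral_eq_of_setIntegral_fiber_eq (hZ n) (hint _ s hs0 hs1)
    (hint _ _ (fun l => (pgf_mem_Icc hs0 hs1 l).1) fun l => (pgf_mem_Icc hs0 hs1 l).2) fun z => ?_
  have hms : MeasurableSet (Z n ⁻¹' {z}) := hZ n (measurableSet_singleton z)
  have hle : offspringAlgebra ξ {a | a.1 < n} ≤ mΩ :=
    iSup₂_le fun a _ => (hmeas a.1 a.2.1 a.2.2).comap_le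
  have hX : Measurable fun ω (b : Fin (M + 1) × ℕ) => ξ n b.1 b.2 ω :=
    measurable_pi_lambda _ fun b => hmeas n b.1 b.2
  have hf : Measurable fun x : Fin (M + 1) × ℕ → Fin (M + 1) → ℕ =>
      ∏ a : Σ l, Fin (z l), ∏ j, s j ^ x (a.1, a.2) j :=
    Finset.measurable_prod _ fun a _ => (Measurable.of_discrete
      (f := fun k : Fin (M + 1) → ℕ => ∏ j, s j ^ k j)).comp (measurable_pi_apply _)
  have hsplit := (indep_past_present hmeas hind n).setIntegral_eq_smul hle hX.aemeasurable
    (measurableSet_generation_offspringAlgebra h0 hstep n z) hf.aestronglyMeasurable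
  rw [integral_prod_offspring hmeas hlaw hind] at hsplit
  calc ∫ ω in Z n ⁻¹' {z}, ∏ j, s j ^ Z (n + 1) ω j ∂P
      = ∫ ω in Z n ⁻¹' {z}, ∏ a : Σ l, Fin (z l), ∏ j, s j ^ ξ n a.1 a.2 ω j ∂P := by
        refine setIntegral_congr_fun hms fun ω hω => ?_
        have hω' : Z n ω = z := hω
        simp only [hstep, hω']
        exact prod_pow_sum_eq s z fun l k => ξ n l k ω
    _ = P.real (Z n ⁻¹' {z}) • ∏ l, pgf ν s l ^ z l := hsplit
    _ = ∫ ω in Z n ⁻¹' {z}, ∏ l, pgf ν s l ^ z l ∂P := by rw [setIntegral_const]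
    _ = ∫ ω in Z n ⁻¹' {z}, ∏ l, pgf ν s l ^ Z n ω l ∂P :=
        setIntegral_congr_fun hms fun ω hω => by
          have hω' : Z n ω = z := hω
          simp only [hω']

theorem integral_prod_pow_eq_iterate (hmeas : ∀ n l k, Measurable (ξ n l k))
    (hlaw : ∀ n l k, P.map (ξ n l k) = ν l)
    (hind : iIndepFun (fun a : ℕ × Fin (M + 1) × ℕ => ξ a.1 a.2.1 a.2.2) P)
    (h0 : ∀ ω, Z 0 ω = Pi.single i 1)
    (hstep : ∀ n ω, Z (n + 1) ω = ∑ l, ∑ k ∈ Finset.range (Z n ω l), ξ n l k ω) (n : ℕ) :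
    ∀ {s : Fin (M + 1) → ℝ}, (∀ j, 0 ≤ s j) → (∀ j, s j ≤ 1) →
      ∫ ω, ∏ j, s j ^ Z n ω j ∂P = (pgf ν)^[n] s i := by
  induction n with
  | zero =>
    intro s _ _
    have : ∀ j, s j ^ (Pi.single i 1 : Fin (M + 1) → ℕ) j = if j = i then s j else 1 := by
      intro j
      by_cases h : j = i
      · subst h; simp
      · simp [h]
    simp [h0, this]
  | succ n ih =>
    intro s hs0 hs1
    rw [integral_prod_pow_succ hmeas hlaw hind h0 hstep n hs0 hs1, Function.iterate_succ_apply]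
    exact ih (fun l => (pgf_mem_Icc hs0 hs1 l).1) fun l => (pgf_mem_Icc hs0 hs1 l).2

/-- Evaluating the generating function of `Z n` at `0`, with `0 ^ 0 = 1`. -/
theorem measureReal_generation_eq_zero (hmeas : ∀ n l k, Measurable (ξ n l k))
    (hlaw : ∀ n l k, P.map (ξ n l k) = ν l)
    (hind : iIndepFun (fun a : ℕ × Fin (M + 1) × ℕ => ξ a.1 a.2.1 a.2.2) P)
    (h0 : ∀ ω, Z 0 ω = Pi.single i 1)
    (hstep : ∀ n ω, Z (n + 1) ω = ∑ l, ∑ k ∈ Finset.range (Z n ω l), ξ n l k ω) (n : ℕ) :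
    P.real {ω | Z n ω = 0} = extinctProb ν n i := by
  have hZ : Measurable (Z n) := measurable_generation h0 hstep fun m _ => hmeas m
  have hset : MeasurableSet {ω | Z n ω = 0} := hZ (measurableSet_singleton 0)
  rw [extinctProb, ← integral_prod_pow_eq_iterate (P := P) hmeas hlaw hind h0 hstep n
    (s := 0) (fun _ => le_rfl) (fun _ => zero_le_one),
    ← integral_indicator_one hset]
  refine integral_congr_ae (.of_forall fun ω => ?_)
  by_cases h : Z n ω = 0
  · simp [h]
  · obtain ⟨j, hj⟩ := Function.ne_iff.1 h
    simp only [Pi.zero_apply] at hj ⊢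
    rw [Set.indicator_of_notMem (by simpa using h), Finset.prod_eq_zero (Finset.mem_univ j)]
    exact zero_pow hj

theorem HypothesisA.measureReal_extinctionMoment_eq (hA : HypothesisA ν)
    (hZ : IsGWProcess P ν i Z) {m : ℕ} (hm : 1 ≤ m) :
    P.real {ω | extinctionMoment Z i (Fin.last M) ω = ((m + 1 : ℕ) : ℕ∞)} =
      survProb ν m i - survProb ν (m + 1) i := by
  obtain ⟨ξ, hmeas, hlaw, hind, h0, hstep⟩ := hZ
  have hset : {ω | extinctionMoment Z i (Fin.last M) ω = ((m + 1 : ℕ) : ℕ∞)} =ᵐ[P]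
      ({ω | Z (m + 1) ω = 0} \ {ω | Z m ω = 0} : Set Ω) := by
    filter_upwards [hA.ae_generation_eq_zero hmeas hlaw h0 hstep] with ω hω
    exact propext (extinctionMoment_eq_succ_iff hstep hω hm)
  have hsub : {ω | Z m ω = 0} ⊆ {ω | Z (m + 1) ω = 0} := by
    intro ω hω
    have hω' : Z m ω = 0 := hω
    simp [hstep, hω']
  have hZm : Measurable (Z m) := measurable_generation h0 hstep fun m _ => hmeas m
  rw [measureReal_congr hset, measureReal_sdiff hsub (hZm (measurableSet_singleton 0)),
    measureReal_generation_eq_zero hmeas hlaw hind h0 hstep,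
    measureReal_generation_eq_zero hmeas hlaw hind h0 hstep]
  simp only [survProb]
  ring

end Branching

end

end DecomposableGW

theorem theorem1 {M : ℕ} (ν : Fin (M + 1) → Measure (Fin (M + 1) → ℕ))
    [∀ l, IsProbabilityMeasure (ν l)] (hA : DecomposableGW.HypothesisA ν)
    (i : Fin (M + 1)) {Ω : Type*} [MeasurableSpace Ω] (P : Measure Ω) [IsProbabilityMeasure P]
    (Z : ℕ → Ω → Fin (M + 1) → ℕ) (hZ : DecomposableGW.IsGWProcess P ν i Z) :
    (fun n : ℕ => P.real {ω | DecomposableGW.extinctionMoment Z i (Fin.last M) ω = (n : ℕ∞)})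
      ~[atTop]
    (fun n : ℕ => DecomposableGW.gam i * DecomposableGW.survivalConst ν i /
      (n : ℝ) ^ (1 + DecomposableGW.gam i)) := by
  have hc : 0 < DecomposableGW.gam i * DecomposableGW.survivalConst ν i :=
    mul_pos (DecomposableGW.gam_pos i) (hA.survivalConst_pos i)
  refine (Asymptotics.isEquivalent_iff_tendsto_one ?_).2
    ((tendsto_add_atTop_iff_nat 1).1 ?_)
  · filter_upwards [eventually_gt_atTop 0] with n hn
    have hn' : (0 : ℝ) < n := by exact_mod_cast hn
    positivity
  · have h := ((hA.survivalAsymptotics i).2.mul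
      (DecomposableGW.tendsto_succ_div_rpow (1 + DecomposableGW.gam i))).div_const
      (DecomposableGW.gam i * DecomposableGW.survivalConst ν i)
    rw [mul_one, div_self hc.ne'] at h
    refine h.congr' ((eventually_ge_atTop 1).mono fun m hm => ?_)
    have hm' : (0 : ℝ) < m := by exact_mod_cast hm
    have hm1 : (0 : ℝ) < ((m + 1 : ℕ) : ℝ) := by positivity
    have h1 := Real.rpow_pos_of_pos hm' (1 + DecomposableGW.gam i)
    have h2 := Real.rpow_pos_of_pos hm1 (1 + DecomposableGW.gam i)
    simp only [Pi.div_apply]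
    rw [hA.measureReal_extinctionMoment_eq hZ hm, Real.div_rpow hm1.le hm'.le]
    field_simp
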